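/- Let $d\ge 3$ and write $\xi=(\xi',\xi_d)\in\mathbb R^{d-1}\times\mathbb R$. Let $\widehat f(\xi)=(2\pi)^{-d/2}\int_{\mathbb R^d}e^{-ix\cdot\xi}f(x)\,dx$. Put $D_0=\{x\in\mathbb R^d:|x|\le 1\}$, $D_j=\{x\in\mathbb R^d:2^{j-1}<|x|\le 2^j\}$ for $j\ge 1$, and $$|||f|||_*=\sup_{j\ge 0}2^{-j/2}\|f\|_{L^2(D_j)},\qquad |||f|||=\sum_{j\ge 0}2^{j/2}\|f\|_{L^2(D_j)}.$$ Fix $\phi\in\mathcal S(\mathbb R^d)$ supported in $\{|\xi|\le 2\}$ with $\phi=1$ on $\{|\xi|\le 1\}$, let $\psi(\xi)=\phi(\xi)-\phi(2\xi)$, and define $\widehat{P_kf}(\xi)=\psi(\xi/2^k)\widehat f(\xi)$ and $\widehat{P_{\le k}f}(\xi)=\phi(\xi/2^k)\widehat f(\xi)$ for $k\in\mathbb Z$. For $\lambda>0$ let $k_\lambda\in\mathbb Z$ be such that $2^{k_\lambda-1}<\lambda^{1/2}\le 2^{k_\lambda}$, let $I=\{k_\lambda-2,k_\lambda-1,k_\lambda,k_\lambda+1\}$,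 $m_\lambda(\xi)=|\lambda-|\xi|^2|$, and $$\|f\|_{Y_\lambda^*}^2=\|m_\lambda^{1/2}\widehat{P_{\le k_\lambda-3}f}\|_{L^2}^2+\sum_{k\in I}\lambda^{1/2}|||P_kf|||_*^2+\sum_{k>k_\lambda+1}\|m_\lambda^{1/2}\widehat{P_kf}\|_{L^2}^2 .$$ For $\tau>0$ let $q_\tau(\xi)=-|\xi|^2+2i\tau\xi_d+\tau^2$, the symbol of $\Delta+2\tau\partial_{x_d}+\tau^2$, let $\|f\|_{\dot Y_\tau^{1/2}}=\||q_\tau|^{1/2}\widehat f\|_{L^2}$, and let $(\Delta+2\tau\partial_{x_d}+\tau^2)^{-1}f$ be the inverse Fourier transform of $\widehat f/q_\tau$. Then: 1. There is a constant $C>0$ depending only on $d$ (and on the fixed function $\phi$) such that $\|f\|_{Y_\lambda^*}\le C\|f\|_{\dot Y_\tau^{1/2}}$ for all $f\in\mathcal S(\mathbb R^d)$, $\tau>0$ and $\lambda=\tau^2$. 2. For every $\chi\in\mathcal S(\mathbb R^d)$ there is a constant $C>0$ depending only on $d$ and $\chi$ such that $\tau^{1/2}\|\chi f\|_{L^2}\le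 C\|f\|_{\dot Y_\tau^{1/2}}$ for all $f\in\mathcal S(\mathbb R^d)$ and $\tau>0$. 3. There is a constant $C>0$ depending only on $d$ such that, for all $f\in\mathcal S(\mathbb R^d)$ and $\tau>0$, the function $\widehat f/q_\tau$ is integrable on $\mathbb R^d$ and $$|||(\Delta+2\tau\partial_{x_d}+\tau^2)^{-1}f|||_*\le\frac C\tau\,|||f||| .$$ -/

import Mathlib

open MeasureTheory
open scoped SchwartzMap ENNReal

noncomputable section

/-- The Euclidean space `ℝ^d`. -/
abbrev Eucl (d : ℕ) : Type := EuclideanSpace ℝ (Fin d)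

/-- The unitary Fourier transform in angular frequency,
`F g (ξ) = (2π)^(-d/2) ∫ e^(-i x·ξ) g(x) dx`. -/
def fourierHat {d : ℕ} (g : Eucl d → ℂ) (ξ : Eucl d) : ℂ :=
  (((2 * Real.pi) ^ (-(d : ℝ) / 2) : ℝ) : ℂ) *
    ∫ x : Eucl d, Complex.exp (-Complex.I * ((inner ℝ x ξ : ℝ) : ℂ)) * g x

/-- The inverse of the unitary Fourier transform,
`F⁻¹ g (x) = (2π)^(-d/2) ∫ e^(i x·ξ) g(ξ) dξ`. -/
def fourierCheck {d : ℕ} (g : Eucl d → ℂ) (x : Eucl d) : ℂ :=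
  (((2 * Real.pi) ^ (-(d : ℝ) / 2) : ℝ) : ℂ) *
    ∫ ξ : Eucl d, Complex.exp (Complex.I * ((inner ℝ x ξ : ℝ) : ℂ)) * g ξ

/-- The dyadic pieces: `D_0 = {|x| ≤ 1}` and `D_j = {2^(j-1) < |x| ≤ 2^j}` for `j ≥ 1`. -/
def dyadicShell (d : ℕ) : ℕ → Set (Eucl d)
  | 0 => {x | ‖x‖ ≤ 1}
  | j + 1 => {x | (2 : ℝ) ^ j < ‖x‖ ∧ ‖x‖ ≤ (2 : ℝ) ^ (j + 1)}

/-- `|||g|||_* = sup_j 2^(-j/2) ‖g‖_{L²(D_j)}`. -/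
def tripleStar {d : ℕ} (g : Eucl d → ℂ) : ℝ≥0∞ :=
  ⨆ j : ℕ, ENNReal.ofReal ((2 : ℝ) ^ (-(j : ℝ) / 2)) *
    eLpNorm g 2 (volume.restrict (dyadicShell d j))

/-- `|||g||| = ∑_j 2^(j/2) ‖g‖_{L²(D_j)}`. -/
def tripleNorm {d : ℕ} (g : Eucl d → ℂ) : ℝ≥0∞ :=
  ∑' j : ℕ, ENNReal.ofReal ((2 : ℝ) ^ ((j : ℝ) / 2)) *
    eLpNorm g 2 (volume.restrict (dyadicShell d j))

/-- A base function of the Littlewood–Paley decomposition: a Schwartz function supported in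
`{|ξ| ≤ 2}` and equal to `1` on `{|ξ| ≤ 1}`. -/
structure IsLPBase {d : ℕ} (φ : 𝓢(Eucl d, ℂ)) : Prop where
  support_subset : ∀ ξ : Eucl d, 2 < ‖ξ‖ → φ ξ = 0
  eq_one : ∀ ξ : Eucl d, ‖ξ‖ ≤ 1 → φ ξ = 1

/-- `ψ(ξ) = φ(ξ) - φ(2ξ)`. -/
def lpPsi {d : ℕ} (φ : 𝓢(Eucl d, ℂ)) (ξ : Eucl d) : ℂ := φ ξ - φ ((2 : ℝ) • ξ)

/-- The Fourier transform of `P_k f`, that is, `ψ(ξ/2^k) (F f)(ξ)`. -/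
def lpHat {d : ℕ} (φ : 𝓢(Eucl d, ℂ)) (k : ℤ) (f : 𝓢(Eucl d, ℂ)) (ξ : Eucl d) : ℂ :=
  lpPsi φ (((2 : ℝ) ^ k)⁻¹ • ξ) * fourierHat f ξ

/-- The Fourier transform of `P_{≤ k} f`, that is, `φ(ξ/2^k) (F f)(ξ)`. -/
def lpLowHat {d : ℕ} (φ : 𝓢(Eucl d, ℂ)) (k : ℤ) (f : 𝓢(Eucl d, ℂ)) (ξ : Eucl d) : ℂ :=
  φ (((2 : ℝ) ^ k)⁻¹ • ξ) * fourierHat f ξ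

/-- The Littlewood–Paley projector `P_k f`. -/
def lpProj {d : ℕ} (φ : 𝓢(Eucl d, ℂ)) (k : ℤ) (f : 𝓢(Eucl d, ℂ)) : Eucl d → ℂ :=
  fourierCheck (lpHat φ k f)

/-- The integer `k_lam` with `2^(k_lam - 1) < lam^(1/2) ≤ 2^(k_lam)`. -/
def critScale (lam : ℝ) : ℤ := Int.clog 2 (√lam)

theorem critScale_spec {lam : ℝ} (h : 0 < lam) :
    (2 : ℝ) ^ (critScale lam - 1) < √lam ∧ √lam ≤ (2 : ℝ) ^ critScale lam := by
  have h0 : 0 < √lam := Real.sqrt_pos.mpr h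
  exact ⟨by simpa [critScale] using Int.zpow_pred_clog_lt_self (b := 2) (by norm_num) h0,
    by simpa [critScale] using Int.self_le_zpow_clog (b := 2) (by norm_num) (√lam)⟩

/-- `m_lam(ξ) = |lam - |ξ|²|`. -/
def mSymbol {d : ℕ} (lam : ℝ) (ξ : Eucl d) : ℝ := |lam - ‖ξ‖ ^ 2|

/-- The norm of `Y_lam^*`, whose square is
`‖m^(1/2) F(P_{<I} f)‖² + ∑_{k ∈ I} lam^(1/2) |||P_k f|||_*² + ∑_{k > k_lam + 1} ‖m^(1/2) F(P_k f)‖²`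
with `I = {k_lam - 2, …, k_lam + 1}` and `P_{<I} = P_{≤ k_lam - 3}`. -/
def yStarNorm {d : ℕ} (φ : 𝓢(Eucl d, ℂ)) (lam : ℝ) (f : 𝓢(Eucl d, ℂ)) : ℝ≥0∞ :=
  ((eLpNorm (fun ξ => ((√(mSymbol lam ξ) : ℝ) : ℂ) * lpLowHat φ (critScale lam - 3) f ξ)
        2 volume) ^ 2
    + ∑ k ∈ Finset.Icc (critScale lam - 2) (critScale lam + 1),
        ENNReal.ofReal (√lam) * (tripleStar (lpProj φ k f)) ^ 2
    + ∑' k : Set.Ioi (critScale lam + 1),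
        (eLpNorm (fun ξ => ((√(mSymbol lam ξ) : ℝ) : ℂ) * lpHat φ (k : ℤ) f ξ)
          2 volume) ^ 2) ^ (1 / 2 : ℝ)

/-- The last coordinate `ξ_d` (a dummy value in dimension `0`). -/
def lastCoord {d : ℕ} (ξ : Eucl d) : ℝ :=
  if h : 0 < d then ξ ⟨d - 1, Nat.sub_lt h Nat.one_pos⟩ else 0

/-- `q_τ(ξ) = -|ξ|² + 2iτ ξ_d + τ²`, the symbol of the conjugated Laplacian
`Δ + 2τ ∂_{x_d} + τ²`. -/
def qSymbol {d : ℕ} (τ : ℝ) (ξ : Eucl d) : ℂ :=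
  -((‖ξ‖ ^ 2 : ℝ) : ℂ) + Complex.I * ((2 * τ * lastCoord ξ : ℝ) : ℂ) + ((τ ^ 2 : ℝ) : ℂ)

/-- The homogeneous Bourgain norm `‖ |q_τ|^s F f ‖_{L²}`. -/
def yDotNorm {d : ℕ} (s τ : ℝ) (f : 𝓢(Eucl d, ℂ)) : ℝ≥0∞ :=
  eLpNorm (fun ξ => ((‖qSymbol τ ξ‖ ^ s : ℝ) : ℂ) * fourierHat f ξ) 2 volume

/-- The inverse `(Δ + 2τ ∂_{x_d} + τ²)⁻¹ f` of the conjugated Laplacian, that is, the Fourier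
multiplier operator with symbol `1 / q_τ`. -/
def conjLaplacianInv {d : ℕ} (τ : ℝ) (f : 𝓢(Eucl d, ℂ)) : Eucl d → ℂ :=
  fourierCheck (fun ξ => fourierHat f ξ / qSymbol τ ξ)

end

/-! Two mechanisms carry the theorem.

For claims 1 and 2, put a Gaussian weight of radius `R` on the energy of an inverse Fourier
transform. Expanding the square gives a quadratic form in `h` whose kernel is a normalized Gaussian
of width `1 / R` (`lintegral_gaussian_fourierCheck_le`). The Schur test with weight `|q_τ|` bounds
it by `∫ |h|² |q_τ|`, provided that the convolution of that Gaussian with `1 / |q_τ|` is `O(R / τ)`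
uniformly (`exists_lintegral_gaussDensity_inv_qSymbol_le`). The convolution bound comes from
slicing. If some `|ξ_m| ≥ cτ` with `m ≠ d`, then `|q_τ|` dominates both `τ |ξ_d|` and `τ` times the
distance from `|ξ_m|` to a root, so `1 / |q_τ|` is at most a product of two inverse square roots in
different variables, each contributing `√R`. If no such `m` exists, `|q_τ| ≥ τ² / 2` and only a slab
of small Gaussian mass matters. With `R = 2^j` this gives `τ |||ȟ|||_*² ≤ C ∫ |h|² |q_τ|`
(`exists_tripleStar_fourierCheck_sq_le`). It handles the critical frequencies in claim 1, and claim
2 after summing the decay of `χ` over shells. The remaining frequencies in claim 1 only need `m_λ =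
|Re q_τ| ≤ |q_τ|` and finite overlap.

For claim 3, write `|ξ|² + τ² = q_τ + 2 ∑_{m ≠ d} ξ_m² + 2 ξ_d (ξ_d - iτ)` and divide by `q_τ (|ξ|²
+ τ²)`. Each resulting piece of `1 / q_τ` has, in one coordinate `m ≠ d`, a Fourier transform of
size `O(1 / τ)` uniformly in the other frequencies: the numerators `ξ_m²` and `ξ_d` compensate for
the degeneracy of `q_τ`. Such a piece acts by convolution in `x_m` with a bounded kernel, hence maps
`L¹_{x_m} L²` to `L^∞_{x_m} L²` (`lintegral_slice_fourierCheck_le`). Cauchy–Schwarz on slabs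
compares these mixed norms with the two dyadic norms (`tripleStar_fourierCheck_le`). -/

noncomputable section

/-! ### Splitting off one coordinate of Euclidean space. -/

/-- Insertion of a real number as the `m`-th coordinate, as a measurable equivalence. -/
def insertCoord {n : ℕ} (m : Fin (n + 1)) : ℝ × Eucl n ≃ᵐ Eucl (n + 1) :=
  ((MeasurableEquiv.prodCongr (MeasurableEquiv.refl ℝ)
    (MeasurableEquiv.toLp 2 (Fin n → ℝ)).symm).trans
    (MeasurableEquiv.piFinSuccAbove (fun _ : Fin (n + 1) => ℝ) m).symm).trans
    (MeasurableEquiv.toLp 2 (Fin (n + 1) → ℝ))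

@[simp] theorem insertCoord_same {n : ℕ} (m : Fin (n + 1)) (p : ℝ × Eucl n) :
    insertCoord m p m = p.1 :=
  Fin.insertNth_apply_same (α := fun _ => ℝ) m p.1 p.2.ofLp

@[simp] theorem insertCoord_succAbove {n : ℕ} (m : Fin (n + 1)) (p : ℝ × Eucl n) (i : Fin n) :
    insertCoord m p (m.succAbove i) = p.2 i :=
  Fin.insertNth_apply_succAbove (α := fun _ => ℝ) m p.1 p.2.ofLp i

theorem measurePreserving_insertCoord {n : ℕ} (m : Fin (n + 1)) :
    MeasurePreserving (insertCoord (n := n) m) (volume.prod volume) volume := by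
  refine MeasurePreserving.trans (MeasurePreserving.trans (μb := volume.prod volume) ?_
    (volume_preserving_piFinSuccAbove (fun _ : Fin (n + 1) => ℝ) m).symm) ?_
  · exact (MeasurePreserving.id volume).prod (PiLp.volume_preserving_ofLp (Fin n))
  · exact PiLp.volume_preserving_toLp (Fin (n + 1))

theorem norm_insertCoord_sq {n : ℕ} (m : Fin (n + 1)) (p : ℝ × Eucl n) :
    ‖insertCoord m p‖ ^ 2 = p.1 ^ 2 + ‖p.2‖ ^ 2 := by
  simp [EuclideanSpace.norm_sq_eq, Fin.sum_univ_succAbove _ m]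

theorem inner_insertCoord {n : ℕ} (m : Fin (n + 1)) (p q : ℝ × Eucl n) :
    inner ℝ (insertCoord m p) (insertCoord m q) = p.1 * q.1 + inner ℝ p.2 q.2 := by
  simp [PiLp.inner_apply, Fin.sum_univ_succAbove _ m, mul_comm]

theorem insertCoord_sub {n : ℕ} (m : Fin (n + 1)) (p q : ℝ × Eucl n) :
    insertCoord m p - insertCoord m q = insertCoord m (p - q) := by
  ext i
  rcases eq_or_ne i m with rfl | h
  · simp
  · obtain ⟨j, rfl⟩ := Fin.exists_succAbove_eq h
    simp

theorem continuous_insertCoord {n : ℕ} (m : Fin (n + 1)) :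
    Continuous (insertCoord (n := n) m) := by
  refine (PiLp.continuous_toLp 2 (fun _ : Fin (n + 1) => ℝ)).comp ?_
  refine continuous_pi fun i => ?_
  change Continuous fun p : ℝ × Eucl n => insertCoord m p i
  rcases eq_or_ne i m with rfl | h
  · simpa using continuous_fst
  · obtain ⟨j, rfl⟩ := Fin.exists_succAbove_eq h
    simp only [insertCoord_succAbove]
    fun_prop

theorem lintegral_insertCoord {n : ℕ} (m : Fin (n + 1)) {g : Eucl (n + 1) → ℝ≥0∞}
    (hg : Measurable g) :
    ∫⁻ ξ, g ξ = ∫⁻ η : Eucl n, ∫⁻ t : ℝ, g (insertCoord m (t, η)) := by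
  rw [← (measurePreserving_insertCoord m).lintegral_comp hg, lintegral_prod_symm]
  exact (hg.comp (insertCoord m).measurable).aemeasurable

theorem lintegral_insertCoord' {n : ℕ} (m : Fin (n + 1)) {g : Eucl (n + 1) → ℝ≥0∞}
    (hg : Measurable g) :
    ∫⁻ ξ, g ξ = ∫⁻ t : ℝ, ∫⁻ η : Eucl n, g (insertCoord m (t, η)) := by
  rw [← (measurePreserving_insertCoord m).lintegral_comp hg, lintegral_prod]
  exact (hg.comp (insertCoord m).measurable).aemeasurable

/-! ### The normalized Gaussian and its Fourier transform. -/

/-- The normalized Gaussian of width `1 / R`. -/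
def gaussDensity {d : ℕ} (R : ℝ) (ξ : Eucl d) : ℝ :=
  (R / (2 * √Real.pi)) ^ d * Real.exp (-(R ^ 2 * ‖ξ‖ ^ 2 / 4))

theorem gaussDensity_insertCoord {n : ℕ} (m : Fin (n + 1)) (R : ℝ) (p : ℝ × Eucl n) :
    gaussDensity R (insertCoord m p) =
      R / (2 * √Real.pi) * Real.exp (-(R ^ 2 * p.1 ^ 2 / 4)) * gaussDensity R p.2 := by
  rw [gaussDensity, gaussDensity, norm_insertCoord_sq, pow_succ,
    show -(R ^ 2 * (p.1 ^ 2 + ‖p.2‖ ^ 2) / 4)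
      = -(R ^ 2 * p.1 ^ 2 / 4) + -(R ^ 2 * ‖p.2‖ ^ 2 / 4) by ring, Real.exp_add]
  ring

theorem continuous_gaussDensity {d : ℕ} (R : ℝ) : Continuous (gaussDensity (d := d) R) := by
  unfold gaussDensity; fun_prop

theorem gaussDensity_nonneg {d : ℕ} {R : ℝ} (hR : 0 < R) (ξ : Eucl d) :
    0 ≤ gaussDensity R ξ := by
  unfold gaussDensity; positivity

theorem gaussDensity_sub_comm {d : ℕ} (R : ℝ) (ξ ζ : Eucl d) :
    gaussDensity R (ξ - ζ) = gaussDensity R (ζ - ξ) := by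
  rw [gaussDensity, gaussDensity, norm_sub_rev]

theorem gauss_const {d : ℕ} {R : ℝ} (hR : 0 < R) :
    (Real.pi / (R ^ 2 / 4)) ^ ((d : ℝ) / 2) = (2 * √Real.pi / R) ^ d := by
  have h : Real.pi / (R ^ 2 / 4) = (2 * √Real.pi / R) ^ 2 := by
    rw [div_pow, mul_pow, Real.sq_sqrt Real.pi_pos.le]; field_simp; norm_num
  have h0 : 0 ≤ 2 * √Real.pi / R := by positivity
  rw [h, ← Real.rpow_natCast _ 2, ← Real.rpow_mul h0, ← Real.rpow_natCast]
  congr 1; push_cast; ring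

theorem lintegral_gaussDensity {d : ℕ} {R : ℝ} (hR : 0 < R) :
    ∫⁻ ξ : Eucl d, ENNReal.ofReal (gaussDensity R ξ) = 1 := by
  have hb : (0 : ℝ) < R ^ 2 / 4 := by positivity
  have key : ∫ ξ : Eucl d, gaussDensity R ξ = 1 := by
    have h := GaussianFourier.integral_rexp_neg_mul_sq_norm (V := Eucl d) hb
    rw [finrank_euclideanSpace_fin, gauss_const hR] at h
    have e : ∀ ξ : Eucl d, gaussDensity R ξ
        = (R / (2 * √Real.pi)) ^ d * Real.exp (-(R ^ 2 / 4) * ‖ξ‖ ^ 2) := fun ξ => by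
      rw [gaussDensity]; congr 2; ring
    simp_rw [e]
    rw [integral_const_mul, h, ← mul_pow]
    have : √Real.pi ≠ 0 := by positivity
    have hR' := hR.ne'
    field_simp
    simp
  -- The Bochner integral of a non-integrable function is `0`, so the value `1` forces
  -- integrability.
  have hint : Integrable (fun ξ : Eucl d => gaussDensity R ξ) := by
    by_contra hn
    rw [integral_undef hn] at key
    exact zero_ne_one key
  rw [← ofReal_integral_eq_lintegral_ofReal hint
    (Filter.Eventually.of_forall fun ξ => gaussDensity_nonneg hR ξ), key, ENNReal.ofReal_one]

theorem lintegral_gaussDensity_sub {d : ℕ} {R : ℝ} (hR : 0 < R) (ξ : Eucl d) :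
    ∫⁻ ζ : Eucl d, ENNReal.ofReal (gaussDensity R (ξ - ζ)) = 1 := by
  rw [lintegral_sub_left_eq_self (fun ζ => ENNReal.ofReal (gaussDensity R ζ)),
    lintegral_gaussDensity hR]

theorem integral_gaussian_modulation {d : ℕ} {R : ℝ} (hR : 0 < R) (ξ ζ : Eucl d) :
    (((2 * Real.pi) ^ (-(d : ℝ) / 2) : ℝ) : ℂ) ^ 2 *
    ∫ x : Eucl d, ((Real.exp (-(‖x‖ ^ 2 / R ^ 2)) : ℝ) : ℂ) *
      (Complex.exp (Complex.I * ((inner ℝ x ξ : ℝ) : ℂ)) *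
        Complex.exp (-Complex.I * ((inner ℝ x ζ : ℝ) : ℂ))) =
      (gaussDensity R (ξ - ζ) : ℝ) := by
  have hb : 0 < (((1 / R ^ 2 : ℝ) : ℂ)).re := by rw [Complex.ofReal_re]; positivity
  have h := GaussianFourier.integral_cexp_neg_mul_sq_norm_add (V := Eucl d) hb Complex.I (ξ - ζ)
  have e : ∀ x : Eucl d, ((Real.exp (-(‖x‖ ^ 2 / R ^ 2)) : ℝ) : ℂ) *
      (Complex.exp (Complex.I * ((inner ℝ x ξ : ℝ) : ℂ)) *
        Complex.exp (-Complex.I * ((inner ℝ x ζ : ℝ) : ℂ))) =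
      Complex.exp (-((1 / R ^ 2 : ℝ) : ℂ) * ‖x‖ ^ 2 +
        Complex.I * ((inner ℝ (ξ - ζ) x : ℝ) : ℂ)) := fun x => by
    rw [Complex.ofReal_exp, ← Complex.exp_add, ← Complex.exp_add, inner_sub_left,
      real_inner_comm x ξ, real_inner_comm x ζ]
    congr 1; push_cast; ring
  simp_rw [e]
  rw [h, finrank_euclideanSpace_fin]
  have hc : ((Real.pi : ℂ) / ((1 / R ^ 2 : ℝ) : ℂ)) ^ ((d : ℂ) / 2)
      = (((Real.pi * R ^ 2) ^ ((d : ℝ) / 2) : ℝ) : ℂ) := by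
    rw [Complex.ofReal_cpow (by positivity)]; congr 1 <;> push_cast <;> simp
  have he : Complex.exp (Complex.I ^ 2 * ‖ξ - ζ‖ ^ 2 / (4 * ((1 / R ^ 2 : ℝ) : ℂ)))
      = ((Real.exp (-(R ^ 2 * ‖ξ - ζ‖ ^ 2 / 4)) : ℝ) : ℂ) := by
    rw [Complex.ofReal_exp, Complex.I_sq]; congr 1
    have : (R : ℂ) ≠ 0 := by exact_mod_cast hR.ne'
    push_cast; field_simp
  rw [hc, he, gaussDensity, ← Complex.ofReal_pow, ← mul_assoc, ← Complex.ofReal_mul,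
    ← Complex.ofReal_mul]
  congr 2
  have h1 : (Real.pi * R ^ 2) = (√Real.pi * R) ^ 2 := by
    rw [mul_pow, Real.sq_sqrt Real.pi_pos.le]
  have h2 : (2 * Real.pi) = (2 * √Real.pi * √Real.pi) := by
    rw [mul_assoc, Real.mul_self_sqrt Real.pi_pos.le]
  have h0 : 0 ≤ √Real.pi * R := by positivity
  rw [← Real.rpow_natCast _ 2, ← Real.rpow_mul (by positivity), h1, ← Real.rpow_natCast _ 2,
    ← Real.rpow_mul h0]
  have e1 : -(d : ℝ) / 2 * ((2 : ℕ) : ℝ) = -(d : ℝ) := by push_cast; ring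
  have e2 : ((2 : ℕ) : ℝ) * ((d : ℝ) / 2) = d := by push_cast; ring
  rw [e1, e2, Real.rpow_neg (by positivity), Real.rpow_natCast, Real.rpow_natCast, ← inv_pow,
    ← mul_pow]
  congr 1
  nth_rewrite 1 [h2]
  have : √Real.pi ≠ 0 := by positivity
  field_simp

theorem integrable_exp_neg_norm_sq {d : ℕ} {R : ℝ} (hR : 0 < R) :
    Integrable (fun x : Eucl d => ((Real.exp (-(‖x‖ ^ 2 / R ^ 2)) : ℝ) : ℂ)) := by
  have hb : 0 < (((1 / R ^ 2 : ℝ) : ℂ)).re := by rw [Complex.ofReal_re]; positivity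
  have h := GaussianFourier.integrable_cexp_neg_mul_sq_norm_add (V := Eucl d) hb 0 0
  refine h.congr (Filter.Eventually.of_forall fun x => ?_)
  simp only [Complex.ofReal_exp]
  congr 1; push_cast; ring

theorem norm_cexp_I_mul_ofReal (s : ℝ) : ‖Complex.exp (Complex.I * (s : ℂ))‖ = 1 := by
  rw [mul_comm, Complex.norm_exp_ofReal_mul_I]

theorem norm_cexp_neg_I_mul_ofReal (s : ℝ) : ‖Complex.exp (-Complex.I * (s : ℂ))‖ = 1 := by
  have := norm_cexp_I_mul_ofReal (-s)
  push_cast at this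
  rwa [neg_mul, ← mul_neg]

/-! ### Gaussian-weighted energy and the Schur test. -/

/-- Writing the squared modulus as a double frequency integral and integrating in `x` first turns
the spatial Gaussian into `gaussDensity R (ξ - ζ)`. Absolute values are taken only afterwards. The
spatial Gaussian is what makes Fubini applicable. -/
theorem lintegral_gaussian_fourierCheck_le {d : ℕ} {R : ℝ} (hR : 0 < R) {h : Eucl d → ℂ}
    (hh : Integrable h) :
    ∫⁻ x, ENNReal.ofReal (Real.exp (-(‖x‖ ^ 2 / R ^ 2))) * ‖fourierCheck h x‖ₑ ^ 2 ≤
      ∫⁻ p : Eucl d × Eucl d,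
        ‖h p.1‖ₑ * ‖h p.2‖ₑ * ENNReal.ofReal (gaussDensity R (p.1 - p.2)) := by
  set c : ℂ := (((2 * Real.pi) ^ (-(d : ℝ) / 2) : ℝ) : ℂ) with hc
  have hcc : (starRingEnd ℂ) c = c := Complex.conj_ofReal _
  let hb : Eucl d → ℂ := fun ζ => (starRingEnd ℂ) (h ζ)
  have hhb : Integrable hb := by
    refine hh.norm.mono' (Complex.continuous_conj.comp_aestronglyMeasurable hh.1) ?_
    exact Filter.Eventually.of_forall fun ζ => by simp [hb]
  let F : Eucl d → Eucl d × Eucl d → ℂ := fun x p =>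
    c ^ 2 * (((Real.exp (-(‖x‖ ^ 2 / R ^ 2)) : ℝ) : ℂ) *
      (Complex.exp (Complex.I * ((inner ℝ x p.1 : ℝ) : ℂ)) *
        Complex.exp (-Complex.I * ((inner ℝ x p.2 : ℝ) : ℂ)))) * (h p.1 * hb p.2)
  have hF : Integrable (Function.uncurry F) (volume.prod (volume : Measure (Eucl d × Eucl d))) := by
    have h1 := ((integrable_exp_neg_norm_sq (d := d) hR).const_mul (c ^ 2)).mul_prod
      (ν := (volume : Measure (Eucl d × Eucl d))) (hh.mul_prod hhb)
    refine h1.norm.mono' ?_ ?_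
    · have : Continuous fun z : Eucl d × (Eucl d × Eucl d) =>
          (Complex.exp (Complex.I * ((inner ℝ z.1 z.2.1 : ℝ) : ℂ)) *
            Complex.exp (-Complex.I * ((inner ℝ z.1 z.2.2 : ℝ) : ℂ))) := by fun_prop
      refine (h1.1.mul this.aestronglyMeasurable).congr
        (Filter.Eventually.of_forall fun z => ?_)
      simp only [Function.uncurry, F, Pi.mul_apply]; ring
    · refine Filter.Eventually.of_forall fun z => le_of_eq ?_
      simp only [Function.uncurry, F, norm_mul, norm_cexp_I_mul_ofReal,
        norm_cexp_neg_I_mul_ofReal, mul_one]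
  have hin : ∀ x, ∫ p, F x p =
      ((Real.exp (-(‖x‖ ^ 2 / R ^ 2)) * ‖fourierCheck h x‖ ^ 2 : ℝ) : ℂ) := by
    intro x
    have e : ∀ p : Eucl d × Eucl d, F x p =
        ((Real.exp (-(‖x‖ ^ 2 / R ^ 2)) : ℝ) : ℂ) * (c ^ 2 *
          ((Complex.exp (Complex.I * ((inner ℝ x p.1 : ℝ) : ℂ)) * h p.1) *
          (Complex.exp (-Complex.I * ((inner ℝ x p.2 : ℝ) : ℂ)) * hb p.2))) := fun p => by
      simp only [F]; ring
    have e2 : ∫ ζ, Complex.exp (-Complex.I * ((inner ℝ x ζ : ℝ) : ℂ)) * hb ζ =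
        (starRingEnd ℂ) (∫ ξ, Complex.exp (Complex.I * ((inner ℝ x ξ : ℝ) : ℂ)) * h ξ) := by
      rw [← integral_conj]
      refine integral_congr_ae (Filter.Eventually.of_forall fun ζ => ?_)
      simp only [hb, map_mul, ← Complex.exp_conj, Complex.conj_I, Complex.conj_ofReal]
    simp_rw [e]
    rw [integral_const_mul, integral_const_mul]
    rw [show (∫ a : Eucl d × Eucl d, Complex.exp (Complex.I * ((inner ℝ x a.1 : ℝ) : ℂ)) * h a.1 *
        (Complex.exp (-Complex.I * ((inner ℝ x a.2 : ℝ) : ℂ)) * hb a.2)) = _ from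
        integral_prod_mul (μ := (volume : Measure (Eucl d))) (ν := (volume : Measure (Eucl d)))
          (fun ξ => Complex.exp (Complex.I * ((inner ℝ x ξ : ℝ) : ℂ)) * h ξ)
          (fun ζ => Complex.exp (-Complex.I * ((inner ℝ x ζ : ℝ) : ℂ)) * hb ζ), e2]
    rw [Complex.ofReal_mul, Complex.ofReal_pow, ← Complex.mul_conj', fourierCheck, map_mul, ← hc,
      hcc]
    ring
  have hGC : Integrable fun x =>
      ((Real.exp (-(‖x‖ ^ 2 / R ^ 2)) * ‖fourierCheck h x‖ ^ 2 : ℝ) : ℂ) := by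
    have := hF.integral_prod_left
    simp only [Function.uncurry_apply_pair, hin] at this
    exact this
  have hG : Integrable fun x => Real.exp (-(‖x‖ ^ 2 / R ^ 2)) * ‖fourierCheck h x‖ ^ 2 := by
    have := hGC.re
    simpa only [RCLike.re_eq_complex_re, Complex.ofReal_re] using this
  have step : ∫⁻ x, ENNReal.ofReal (Real.exp (-(‖x‖ ^ 2 / R ^ 2))) * ‖fourierCheck h x‖ₑ ^ 2 =
      ‖∫ x, ∫ p, F x p‖ₑ := by
    simp_rw [hin]
    rw [integral_complex_ofReal]
    rw [← ofReal_norm, Complex.norm_real, Real.norm_of_nonneg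
      (integral_nonneg fun x => by positivity), ofReal_integral_eq_lintegral_ofReal hG
      (Filter.Eventually.of_forall fun x => by positivity)]
    refine lintegral_congr fun x => ?_
    rw [ENNReal.ofReal_mul (by positivity), ENNReal.ofReal_pow (norm_nonneg _), ofReal_norm]
  rw [step, integral_integral_swap hF]
  refine (enorm_integral_le_lintegral_enorm _).trans (le_of_eq (lintegral_congr fun p => ?_))
  have : ∫ x, F x p = (gaussDensity R (p.1 - p.2) : ℝ) * (h p.1 * hb p.2) := by
    simp only [F]
    rw [integral_mul_const, integral_const_mul, hc, integral_gaussian_modulation hR]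
  rw [this, enorm_mul, enorm_mul, mul_comm]
  congr 1
  · simp [hb]
  · rw [← ofReal_norm, Complex.norm_real, Real.norm_of_nonneg (gaussDensity_nonneg hR _)]

theorem enorm_mul_enorm_le_weighted (a b : ℂ) {v w : ℝ} (hv : 0 < v) (hw : 0 < w) :
    ‖a‖ₑ * ‖b‖ₑ ≤ ENNReal.ofReal (1 / 2) * (‖a‖ₑ ^ 2 * ENNReal.ofReal v * ENNReal.ofReal w⁻¹) +
      ENNReal.ofReal (1 / 2) * (‖b‖ₑ ^ 2 * ENNReal.ofReal w * ENNReal.ofReal v⁻¹) := by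
  rw [← ofReal_norm, ← ofReal_norm, ← ENNReal.ofReal_pow (norm_nonneg _),
    ← ENNReal.ofReal_pow (norm_nonneg _), ← ENNReal.ofReal_mul (by positivity),
    ← ENNReal.ofReal_mul (by positivity), ← ENNReal.ofReal_mul (by positivity),
    ← ENNReal.ofReal_mul (by positivity), ← ENNReal.ofReal_mul (by positivity),
    ← ENNReal.ofReal_mul (by positivity), ← ENNReal.ofReal_mul (by positivity),
    ← ENNReal.ofReal_add (by positivity) (by positivity)]
  refine ENNReal.ofReal_le_ofReal ?_
  have key : 0 ≤ (‖a‖ * v - ‖b‖ * w) ^ 2 / (2 * (v * w)) := by positivity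
  have e : 1 / 2 * (‖a‖ ^ 2 * v * w⁻¹) + 1 / 2 * (‖b‖ ^ 2 * w * v⁻¹) - ‖a‖ * ‖b‖ =
      (‖a‖ * v - ‖b‖ * w) ^ 2 / (2 * (v * w)) := by field_simp; ring
  linarith

/-- Schur test: weighted AM–GM bounds the integrand by the mean of `T` and its reflection. The
Gaussian is even, so both halves have the same integral, and integrating `T` in the second variable
first leaves the factor `A`. -/
theorem lintegral_schur_le {d : ℕ} {R : ℝ} {h : Eucl d → ℂ} (hh : Integrable h)
    {w : Eucl d → ℝ} (hwm : Measurable w) (hw : ∀ᵐ ξ, 0 < w ξ) {A : ℝ≥0∞}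
    (hA : ∀ ξ : Eucl d, ∫⁻ ζ : Eucl d, ENNReal.ofReal (gaussDensity R (ξ - ζ)) *
      ENNReal.ofReal (w ζ)⁻¹ ≤ A) :
    ∫⁻ p : Eucl d × Eucl d,
        ‖h p.1‖ₑ * ‖h p.2‖ₑ * ENNReal.ofReal (gaussDensity R (p.1 - p.2)) ≤
      A * ∫⁻ ξ, ‖h ξ‖ₑ ^ 2 * ENNReal.ofReal (w ξ) := by
  have hGm : Measurable (gaussDensity (d := d) R) := (continuous_gaussDensity R).measurable
  let T : Eucl d × Eucl d → ℝ≥0∞ := fun p => ‖h p.1‖ₑ ^ 2 * ENNReal.ofReal (w p.1) *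
    (ENNReal.ofReal (gaussDensity R (p.1 - p.2)) * ENNReal.ofReal (w p.2)⁻¹)
  have hTm : AEMeasurable T (volume.prod volume) := by
    have h1 : AEMeasurable (fun p : Eucl d × Eucl d => ‖h p.1‖ₑ) (volume.prod volume) :=
      hh.1.enorm.comp_quasiMeasurePreserving Measure.quasiMeasurePreserving_fst
    refine ((h1.pow_const 2).mul ?_).mul ?_
    · exact ((hwm.comp measurable_fst).ennreal_ofReal).aemeasurable
    · refine Measurable.aemeasurable (Measurable.fun_mul ?_ ?_)
      · exact (hGm.comp (measurable_fst.sub measurable_snd)).ennreal_ofReal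
      · exact ((hwm.comp measurable_snd).inv).ennreal_ofReal
  have hTI : ∫⁻ p, T p ∂(volume.prod volume) ≤ A * ∫⁻ ξ, ‖h ξ‖ₑ ^ 2 * ENNReal.ofReal (w ξ) := by
    rw [lintegral_prod _ hTm]
    have hm : AEMeasurable (fun ξ => ‖h ξ‖ₑ ^ 2 * ENNReal.ofReal (w ξ)) :=
      (hh.1.enorm.pow_const 2).mul hwm.ennreal_ofReal.aemeasurable
    rw [← lintegral_const_mul'' _ hm]
    refine lintegral_mono fun ξ => ?_
    simp only [T]
    rw [lintegral_const_mul, mul_comm]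
    · exact mul_le_mul_left (hA ξ) _
    · exact ((hGm.comp (measurable_const.sub measurable_id)).ennreal_ofReal).mul
        (hwm.inv).ennreal_ofReal
  have hswap : ∫⁻ p, T p.swap ∂(volume.prod volume) = ∫⁻ p, T p ∂(volume.prod volume) := by
    exact lintegral_prod_swap T
  have hT2 : AEMeasurable (fun p => T p.swap) (volume.prod volume) := hTm.prod_swap
  have hae : ∀ᵐ p : Eucl d × Eucl d ∂(volume.prod volume), 0 < w p.1 ∧ 0 < w p.2 :=
    (Measure.quasiMeasurePreserving_fst.ae hw).and (Measure.quasiMeasurePreserving_snd.ae hw)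
  calc ∫⁻ p : Eucl d × Eucl d,
        ‖h p.1‖ₑ * ‖h p.2‖ₑ * ENNReal.ofReal (gaussDensity R (p.1 - p.2))
      ≤ ∫⁻ p, (ENNReal.ofReal (1 / 2) * T p + ENNReal.ofReal (1 / 2) * T p.swap)
          ∂(volume.prod volume) := by
        refine lintegral_mono_ae ?_
        filter_upwards [hae] with p hp
        refine (mul_le_mul_left (enorm_mul_enorm_le_weighted (h p.1) (h p.2) hp.1 hp.2) _).trans
          (le_of_eq ?_)
        simp only [T, Prod.fst_swap, Prod.snd_swap]
        rw [gaussDensity_sub_comm R p.2 p.1]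
        ring
    _ = ∫⁻ p, T p ∂(volume.prod volume) := by
        rw [lintegral_add_left' (hTm.const_mul _), lintegral_const_mul'' _ hTm,
          lintegral_const_mul'' _ hT2, hswap, ← add_mul, ← ENNReal.ofReal_add (by norm_num)
          (by norm_num)]
        norm_num
    _ ≤ _ := hTI

theorem lintegral_gaussian_fourierCheck_le_weighted {d : ℕ} {R : ℝ} (hR : 0 < R)
    {h : Eucl d → ℂ} (hh : Integrable h)
    {w : Eucl d → ℝ} (hwm : Measurable w) (hw : ∀ᵐ ξ, 0 < w ξ) {A : ℝ≥0∞}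
    (hA : ∀ ξ : Eucl d, ∫⁻ ζ : Eucl d, ENNReal.ofReal (gaussDensity R (ξ - ζ)) *
      ENNReal.ofReal (w ζ)⁻¹ ≤ A) :
    ∫⁻ x, ENNReal.ofReal (Real.exp (-(‖x‖ ^ 2 / R ^ 2))) * ‖fourierCheck h x‖ₑ ^ 2 ≤
      A * ∫⁻ ξ, ‖h ξ‖ₑ ^ 2 * ENNReal.ofReal (w ξ) :=
  (lintegral_gaussian_fourierCheck_le hR hh).trans (lintegral_schur_le hh hwm hw hA)

theorem setLIntegral_fourierCheck_le_weighted {d : ℕ} {R : ℝ} (hR : 0 < R)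
    {h : Eucl d → ℂ} (hh : Integrable h)
    {w : Eucl d → ℝ} (hwm : Measurable w) (hw : ∀ᵐ ξ, 0 < w ξ) {A : ℝ≥0∞}
    (hA : ∀ ξ : Eucl d, ∫⁻ ζ : Eucl d, ENNReal.ofReal (gaussDensity R (ξ - ζ)) *
      ENNReal.ofReal (w ζ)⁻¹ ≤ A) {S : Set (Eucl d)} (hS : MeasurableSet S)
    (hSR : ∀ x ∈ S, ‖x‖ ≤ R) :
    ∫⁻ x in S, ‖fourierCheck h x‖ₑ ^ 2 ≤
      ENNReal.ofReal (Real.exp 1) * (A * ∫⁻ ξ, ‖h ξ‖ₑ ^ 2 * ENNReal.ofReal (w ξ)) := by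
  refine le_trans ?_ (mul_le_mul_right
    (lintegral_gaussian_fourierCheck_le_weighted hR hh hwm hw hA) _)
  rw [← lintegral_const_mul' _ _ ENNReal.ofReal_ne_top]
  refine le_trans (setLIntegral_mono' hS fun x hx => ?_) (setLIntegral_le_lintegral S _)
  rw [← mul_assoc, ← ENNReal.ofReal_mul (Real.exp_pos _).le, ← Real.exp_add]
  -- On the ball of radius `R` the Gaussian weight is at least `1 / e`, which is the factor
  -- `Real.exp 1`.
  refine le_mul_of_one_le_left' ?_
  rw [← ENNReal.ofReal_one]
  refine ENNReal.ofReal_le_ofReal (Real.one_le_exp ?_)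
  have : ‖x‖ ^ 2 / R ^ 2 ≤ 1 := by
    rw [div_le_one (by positivity)]
    exact pow_le_pow_left₀ (norm_nonneg _) (hSR x hx) 2
  linarith

/-! ### Continuity and the `L²` bound for the Fourier transform. -/

theorem continuous_fourierCheck {d : ℕ} {h : Eucl d → ℂ} (hh : Integrable h) :
    Continuous (fourierCheck h) := by
  refine continuous_const.mul (continuous_of_dominated (bound := fun ξ => ‖h ξ‖) ?_ ?_ hh.norm ?_)
  · intro x
    exact (Continuous.aestronglyMeasurable (by fun_prop)).mul hh.1
  · intro x
    refine Filter.Eventually.of_forall fun ξ => ?_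
    rw [norm_mul, norm_cexp_I_mul_ofReal, one_mul]
  · refine Filter.Eventually.of_forall fun ξ => ?_
    fun_prop

theorem fourierHat_eq_fourierCheck_neg {d : ℕ} (h : Eucl d → ℂ) (ξ : Eucl d) :
    fourierHat h ξ = fourierCheck h (-ξ) := by
  rw [fourierHat, fourierCheck]
  congr 2; ext x
  rw [inner_neg_left, real_inner_comm]
  push_cast
  rw [neg_mul, mul_neg]

theorem continuous_fourierHat {d : ℕ} {h : Eucl d → ℂ} (hh : Integrable h) :
    Continuous (fourierHat h) := by
  rw [show fourierHat h = fun ξ => fourierCheck h (-ξ) from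
    funext (fourierHat_eq_fourierCheck_neg h)]
  exact (continuous_fourierCheck hh).comp continuous_neg

/-- The half of Plancherel that is needed. The Schur test with weight `1` and constant `1` gives the
bound under every Gaussian cutoff, and Fatou's lemma removes the cutoff as the radius tends to
infinity. -/
theorem lintegral_fourierCheck_sq_le {d : ℕ} {h : Eucl d → ℂ} (hh : Integrable h) :
    ∫⁻ x, ‖fourierCheck h x‖ₑ ^ 2 ≤ ∫⁻ ξ, ‖h ξ‖ₑ ^ 2 := by
  have hb : ∀ k : ℕ, ∫⁻ x, ENNReal.ofReal (Real.exp (-(‖x‖ ^ 2 / ((k : ℝ) + 1) ^ 2))) *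
      ‖fourierCheck h x‖ₑ ^ 2 ≤ ∫⁻ ξ, ‖h ξ‖ₑ ^ 2 := fun k => by
    have hR : (0 : ℝ) < (k : ℝ) + 1 := by positivity
    have := lintegral_gaussian_fourierCheck_le_weighted hR hh (w := fun _ => 1) measurable_const
      (Filter.Eventually.of_forall fun _ => one_pos) (A := 1) (fun ξ => by
        simpa using (lintegral_gaussDensity_sub hR ξ).le)
    simpa using this
  have hm := (continuous_fourierCheck hh).measurable
  have hlim : ∀ x : Eucl d, Filter.Tendsto (fun k : ℕ =>
      ENNReal.ofReal (Real.exp (-(‖x‖ ^ 2 / ((k : ℝ) + 1) ^ 2))) * ‖fourierCheck h x‖ₑ ^ 2)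
      Filter.atTop (nhds (‖fourierCheck h x‖ₑ ^ 2)) := fun x => by
    have h1 : Filter.Tendsto (fun k : ℕ => ((k : ℝ) + 1) ^ 2) Filter.atTop Filter.atTop :=
      (Filter.tendsto_pow_atTop two_ne_zero).comp
        (tendsto_natCast_atTop_atTop.atTop_add tendsto_const_nhds)
    have h2 : Filter.Tendsto (fun k : ℕ =>
        ENNReal.ofReal (Real.exp (-(‖x‖ ^ 2 / ((k : ℝ) + 1) ^ 2)))) Filter.atTop (nhds 1) := by
      have h3 := ENNReal.tendsto_ofReal ((Real.continuous_exp.tendsto _).comp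
        (h1.const_div_atTop (‖x‖ ^ 2)).neg)
      rwa [neg_zero, Real.exp_zero, ENNReal.ofReal_one] at h3
    simpa using ENNReal.Tendsto.mul_const h2 (Or.inl one_ne_zero)
  calc ∫⁻ x, ‖fourierCheck h x‖ₑ ^ 2
      = ∫⁻ x, Filter.liminf (fun k : ℕ =>
        ENNReal.ofReal (Real.exp (-(‖x‖ ^ 2 / ((k : ℝ) + 1) ^ 2))) * ‖fourierCheck h x‖ₑ ^ 2)
          Filter.atTop := lintegral_congr fun x => (hlim x).liminf_eq.symm
    _ ≤ Filter.liminf (fun k : ℕ => ∫⁻ x,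
        ENNReal.ofReal (Real.exp (-(‖x‖ ^ 2 / ((k : ℝ) + 1) ^ 2))) * ‖fourierCheck h x‖ₑ ^ 2)
          Filter.atTop := lintegral_liminf_le fun k => by fun_prop
    _ ≤ _ := Filter.liminf_le_of_le (by isBoundedDefault) fun b hb' =>
        (hb'.exists.choose_spec).trans (hb _)

theorem lintegral_fourierHat_sq_le {d : ℕ} {h : Eucl d → ℂ} (hh : Integrable h) :
    ∫⁻ ξ, ‖fourierHat h ξ‖ₑ ^ 2 ≤ ∫⁻ x, ‖h x‖ₑ ^ 2 := by
  simp_rw [fourierHat_eq_fourierCheck_neg]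
  rw [lintegral_neg_eq_self (fun x => ‖fourierCheck h x‖ₑ ^ 2)]
  exact lintegral_fourierCheck_sq_le hh

/-! ### Inverse square roots and slabs against a Gaussian. -/

theorem lintegral_Ioc_rpow_neg_half {δ : ℝ} (hδ : 0 < δ) :
    ∫⁻ u in Set.Ioc 0 δ, ENNReal.ofReal (u ^ (-1 / 2 : ℝ)) = ENNReal.ofReal (2 * √δ) := by
  have hi : IntervalIntegrable (fun u : ℝ => u ^ (-1 / 2 : ℝ)) volume 0 δ :=
    intervalIntegral.intervalIntegrable_rpow' (by norm_num)
  rw [← ofReal_integral_eq_lintegral_ofReal hi.1, ← intervalIntegral.integral_of_le hδ.le,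
    integral_rpow (Or.inl (by norm_num))]
  · congr 1
    rw [Real.sqrt_eq_rpow, Real.zero_rpow (by norm_num)]
    norm_num
    ring
  · exact (ae_restrict_iff' measurableSet_Ioc).mpr (Filter.Eventually.of_forall fun u hu =>
      Real.rpow_nonneg hu.1.le _)

theorem lintegral_abs_sub_rpow_neg_half_le {δ : ℝ} (hδ : 0 < δ) (b : ℝ) :
    ∫⁻ t, (if |t - b| ≤ δ then ENNReal.ofReal (|t - b| ^ (-1 / 2 : ℝ)) else 0) ≤
      ENNReal.ofReal (4 * √δ) := by
  rw [lintegral_sub_right_eq_self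
    (fun u : ℝ => if |u| ≤ δ then ENNReal.ofReal (|u| ^ (-1 / 2 : ℝ)) else 0)]
  let g : ℝ → ℝ≥0∞ := (Set.Ioc 0 δ).indicator fun u => ENNReal.ofReal (u ^ (-1 / 2 : ℝ))
  have hg : Measurable g := Measurable.indicator (by fun_prop) measurableSet_Ioc
  have hgI : ∫⁻ u, g u = ENNReal.ofReal (2 * √δ) := by
    rw [lintegral_indicator measurableSet_Ioc, lintegral_Ioc_rpow_neg_half hδ]
  calc _ ≤ ∫⁻ u, (g u + g (-u)) := by
        refine lintegral_mono fun u => ?_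
        split_ifs with h
        · rcases lt_trichotomy u 0 with h0 | rfl | h0
          · refine le_trans (le_of_eq ?_) le_add_self
            rw [abs_of_neg h0] at h ⊢
            simp only [g]
            rw [Set.indicator_of_mem (by constructor <;> linarith)]
          · rw [abs_zero, Real.zero_rpow (by norm_num)]; simp
          · refine le_trans (le_of_eq ?_) le_self_add
            rw [abs_of_pos h0] at h ⊢
            simp only [g]
            rw [Set.indicator_of_mem (by constructor <;> linarith)]
        · exact zero_le
    _ = _ := by
        rw [lintegral_add_left hg, lintegral_neg_eq_self g, hgI,
          ← ENNReal.ofReal_add (by positivity) (by positivity)]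
        congr 1; ring

/-- The one-dimensional factor of `gaussDensity`. -/
def lineGauss (R u : ℝ) : ℝ := R / (2 * √Real.pi) * Real.exp (-(R ^ 2 * u ^ 2 / 4))

theorem gaussDensity_insertCoord_sub {n : ℕ} (m : Fin (n + 1)) (R : ℝ) (p q : ℝ × Eucl n) :
    gaussDensity R (insertCoord m p - insertCoord m q) =
      lineGauss R (p.1 - q.1) * gaussDensity R (p.2 - q.2) := by
  rw [insertCoord_sub, gaussDensity_insertCoord]; rfl

theorem continuous_lineGauss (R : ℝ) : Continuous (lineGauss R) := by
  unfold lineGauss; fun_prop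

theorem lineGauss_nonneg {R : ℝ} (hR : 0 < R) (u : ℝ) : 0 ≤ lineGauss R u := by
  unfold lineGauss; positivity

theorem lineGauss_le {R : ℝ} (hR : 0 < R) (u : ℝ) : lineGauss R u ≤ R := by
  have h1 : Real.exp (-(R ^ 2 * u ^ 2 / 4)) ≤ 1 := Real.exp_le_one_iff.mpr (by
    have : 0 ≤ R ^ 2 * u ^ 2 / 4 := by positivity
    linarith)
  have h2 : 1 ≤ 2 * √Real.pi := by
    have : 1 ≤ √Real.pi := Real.one_le_sqrt.mpr (by linarith [Real.pi_gt_three])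
    linarith
  calc lineGauss R u ≤ R / (2 * √Real.pi) * 1 := by
        unfold lineGauss; gcongr
    _ ≤ R := by rw [mul_one]; exact div_le_self hR.le h2

theorem lintegral_lineGauss {R : ℝ} (hR : 0 < R) (a : ℝ) :
    ∫⁻ t, ENNReal.ofReal (lineGauss R (a - t)) = 1 := by
  rw [lintegral_sub_left_eq_self (fun u => ENNReal.ofReal (lineGauss R u))]
  have h := lintegral_gaussDensity (d := 1) hR
  rw [lintegral_insertCoord (0 : Fin 1) (continuous_gaussDensity R).measurable.ennreal_ofReal] at h
  simp only [gaussDensity_insertCoord] at h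
  have hd : (volume : Measure (Eucl 0)) = Measure.dirac 0 := by
    exact volume_euclideanSpace_eq_dirac (ι := Fin 0)
  rw [hd, lintegral_dirac] at h
  simpa [gaussDensity, lineGauss] using h

/-- Split at `|t - b| = 1 / R`. Nearby the Gaussian is at most `R` and the singularity integrates to
`4 / √R`; farther away the singularity is at most `√R` and the Gaussian has mass `1`. -/
theorem lintegral_lineGauss_mul_rpow_le {R : ℝ} (hR : 0 < R) (a b : ℝ) :
    ∫⁻ t, ENNReal.ofReal (lineGauss R (a - t)) * ENNReal.ofReal (|t - b| ^ (-1 / 2 : ℝ)) ≤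
      ENNReal.ofReal (5 * √R) := by
  have hδ : 0 < R⁻¹ := inv_pos.mpr hR
  have hm : Measurable fun t : ℝ => ENNReal.ofReal (lineGauss R (a - t)) :=
    ((continuous_lineGauss R).comp (continuous_const.sub continuous_id)).measurable.ennreal_ofReal
  calc _ ≤ ∫⁻ t, (ENNReal.ofReal (lineGauss R (a - t)) * ENNReal.ofReal (√R) +
        ENNReal.ofReal R *
          (if |t - b| ≤ R⁻¹ then ENNReal.ofReal (|t - b| ^ (-1 / 2 : ℝ)) else 0)) := by
        refine lintegral_mono fun t => ?_
        split_ifs with h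
        · refine le_trans ?_ le_add_self
          gcongr
          exact lineGauss_le hR _
        · refine le_trans ?_ le_self_add
          gcongr
          push Not at h
          calc |t - b| ^ (-1 / 2 : ℝ) ≤ (R⁻¹) ^ (-1 / 2 : ℝ) :=
                Real.rpow_le_rpow_of_nonpos hδ h.le (by norm_num)
            _ = √R := by
                rw [Real.inv_rpow hR.le, ← Real.rpow_neg hR.le, Real.sqrt_eq_rpow]; norm_num
    _ ≤ ENNReal.ofReal (√R) + ENNReal.ofReal R * ENNReal.ofReal (4 * √R⁻¹) := by
        rw [lintegral_add_left (hm.mul_const _), lintegral_mul_const _ hm,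
          lintegral_lineGauss hR, one_mul, lintegral_const_mul' _ _ ENNReal.ofReal_ne_top]
        gcongr
        exact lintegral_abs_sub_rpow_neg_half_le hδ b
    _ = _ := by
        rw [← ENNReal.ofReal_mul hR.le, ← ENNReal.ofReal_add (by positivity) (by positivity)]
        congr 1
        rw [Real.sqrt_inv]
        have : 0 < √R := Real.sqrt_pos.mpr hR
        field_simp
        rw [Real.sq_sqrt hR.le]; ring

theorem lintegral_lineGauss_abs_lt_le {R δ : ℝ} (hR : 0 < R) (a : ℝ) :
    ∫⁻ t, ENNReal.ofReal (lineGauss R (a - t)) * (if |t| < δ then 1 else 0) ≤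
      ENNReal.ofReal (2 * R * δ) := by
  calc _ ≤ ∫⁻ t, (Set.Ioo (-δ) δ).indicator (fun _ => ENNReal.ofReal R) t := by
        refine lintegral_mono fun t => ?_
        split_ifs with h
        · rw [Set.indicator_of_mem (Set.mem_Ioo.mpr (abs_lt.mp h)), mul_one]
          exact ENNReal.ofReal_le_ofReal (lineGauss_le hR _)
        · simp
    _ = _ := by
        rw [lintegral_indicator measurableSet_Ioo, setLIntegral_const, Real.volume_Ioo,
          ← ENNReal.ofReal_mul hR.le]
        congr 1; ring

theorem lintegral_gaussDensity_mul_rpow_le {n : ℕ} {R : ℝ} (hR : 0 < R) (j : Fin (n + 1))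
    (ξ : Eucl (n + 1)) :
    ∫⁻ η : Eucl (n + 1), ENNReal.ofReal (gaussDensity R (ξ - η)) *
      ENNReal.ofReal (|η j| ^ (-1 / 2 : ℝ)) ≤ ENNReal.ofReal (5 * √R) := by
  have hGm : ∀ {k : ℕ} (ξ : Eucl k), Measurable fun η : Eucl k =>
      ENNReal.ofReal (gaussDensity R (ξ - η)) := fun ξ =>
    ((continuous_gaussDensity R).comp (continuous_const.sub continuous_id)).measurable.ennreal_ofReal
  have hjm : Measurable fun η : Eucl (n + 1) => ENNReal.ofReal (|η j| ^ (-1 / 2 : ℝ)) := by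
    fun_prop
  obtain ⟨⟨a, x⟩, rfl⟩ := (insertCoord j).surjective ξ
  rw [lintegral_insertCoord j ((hGm _).fun_mul hjm)]
  calc _ ≤ ∫⁻ η : Eucl n, ENNReal.ofReal (gaussDensity R (x - η)) * ENNReal.ofReal (5 * √R) := by
        refine lintegral_mono fun η => ?_
        simp only [gaussDensity_insertCoord_sub, insertCoord_same]
        calc _ = ∫⁻ t, ENNReal.ofReal (gaussDensity R (x - η)) *
              (ENNReal.ofReal (lineGauss R (a - t)) *
                ENNReal.ofReal (|t - 0| ^ (-1 / 2 : ℝ))) := by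
              refine lintegral_congr fun t => ?_
              rw [ENNReal.ofReal_mul (lineGauss_nonneg hR _), sub_zero]; ring
          _ ≤ _ := by
              rw [lintegral_const_mul' _ _ ENNReal.ofReal_ne_top]
              gcongr
              exact lintegral_lineGauss_mul_rpow_le hR a 0
    _ = _ := by rw [lintegral_mul_const _ (hGm x), lintegral_gaussDensity_sub hR, one_mul]

/-! ### Lower bounds for the symbol. -/

theorem lastCoord_succ {n : ℕ} (ξ : Eucl (n + 1)) : lastCoord ξ = ξ (Fin.last n) := by
  rw [lastCoord, dif_pos (Nat.succ_pos n)]; rfl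

theorem continuous_lastCoord {d : ℕ} : Continuous (lastCoord (d := d)) := by
  unfold lastCoord
  split_ifs <;> fun_prop

theorem continuous_qSymbol {d : ℕ} (τ : ℝ) : Continuous (qSymbol (d := d) τ) := by
  have := continuous_lastCoord (d := d)
  unfold qSymbol
  fun_prop

theorem qSymbol_re {d : ℕ} (τ : ℝ) (ξ : Eucl d) : (qSymbol τ ξ).re = τ ^ 2 - ‖ξ‖ ^ 2 := by
  have : qSymbol τ ξ = ((τ ^ 2 - ‖ξ‖ ^ 2 : ℝ) : ℂ) + ((2 * τ * lastCoord ξ : ℝ) : ℂ) * Complex.I := by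
    rw [qSymbol]; push_cast; ring
  rw [this]; simp only [Complex.add_re, Complex.ofReal_re, Complex.re_ofReal_mul, Complex.I_re]
  ring

theorem qSymbol_im {d : ℕ} (τ : ℝ) (ξ : Eucl d) : (qSymbol τ ξ).im = 2 * τ * lastCoord ξ := by
  have : qSymbol τ ξ = ((τ ^ 2 - ‖ξ‖ ^ 2 : ℝ) : ℂ) + ((2 * τ * lastCoord ξ : ℝ) : ℂ) * Complex.I := by
    rw [qSymbol]; push_cast; ring
  rw [this]; simp only [Complex.add_im, Complex.ofReal_im, Complex.im_ofReal_mul, Complex.I_im]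
  ring

theorem abs_sub_norm_sq_le_norm_qSymbol {d : ℕ} (τ : ℝ) (ξ : Eucl d) :
    |τ ^ 2 - ‖ξ‖ ^ 2| ≤ ‖qSymbol τ ξ‖ := by
  rw [← qSymbol_re]; exact Complex.abs_re_le_norm _

theorem two_mul_abs_lastCoord_le_norm_qSymbol {d : ℕ} {τ : ℝ} (hτ : 0 < τ) (ξ : Eucl d) :
    2 * τ * |lastCoord ξ| ≤ ‖qSymbol τ ξ‖ := by
  have := Complex.abs_im_le_norm (qSymbol τ ξ)
  rwa [qSymbol_im, abs_mul, abs_of_pos (by positivity : 0 < 2 * τ)] at this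

theorem ae_coord_ne_zero {n : ℕ} (j : Fin (n + 1)) : ∀ᵐ ξ : Eucl (n + 1), ξ j ≠ 0 := by
  have h : ∀ᵐ p : ℝ × Eucl n ∂(volume.prod volume), insertCoord j p j ≠ 0 := by
    simp only [insertCoord_same]
    exact Measure.quasiMeasurePreserving_fst.ae (Measure.ae_ne volume (0 : ℝ))
  have h2 := (measurePreserving_insertCoord j).symm.quasiMeasurePreserving.ae h
  simpa using h2

theorem ae_norm_qSymbol_pos {n : ℕ} {τ : ℝ} (hτ : 0 < τ) :
    ∀ᵐ ξ : Eucl (n + 1), 0 < ‖qSymbol τ ξ‖ := by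
  filter_upwards [ae_coord_ne_zero (Fin.last n)] with ξ hξ
  have := two_mul_abs_lastCoord_le_norm_qSymbol hτ ξ
  rw [lastCoord_succ] at this
  have h2 : 0 < |ξ (Fin.last n)| := abs_pos.mpr hξ
  refine lt_of_lt_of_le (by positivity) this

theorem rpow_neg_half_eq_inv_sqrt {x : ℝ} (hx : 0 ≤ x) : x ^ (-1 / 2 : ℝ) = (√x)⁻¹ := by
  rw [Real.sqrt_eq_rpow, ← Real.rpow_neg hx]; norm_num

/-- For `B ≥ 0`, factor the difference of squares. For `B ≤ 0`, `√B` is `0` by convention and there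
is no cancellation, so both signs of `τ² - |η|²` are covered at once. -/
theorem abs_mul_abs_abs_sub_sqrt_le (B t : ℝ) : |t| * |(|t| - √B)| ≤ |B - t ^ 2| := by
  rcases le_total 0 B with hB | hB
  · have : B - t ^ 2 = -((|t| + √B) * (|t| - √B)) := by
      have h1 := Real.mul_self_sqrt hB
      have h2 := abs_mul_abs_self t
      nlinarith
    rw [this, abs_neg, abs_mul]
    refine mul_le_mul_of_nonneg_right ?_ (abs_nonneg _)
    rw [abs_of_nonneg (by positivity : 0 ≤ |t| + √B)]
    linarith [Real.sqrt_nonneg B]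
  · rw [Real.sqrt_eq_zero_of_nonpos hB, sub_zero, abs_abs, abs_mul_abs_self, abs_sub_comm]
    exact le_trans (by nlinarith) (le_abs_self _)

/-- With `v` the distance from `t` to the root of the same sign, `Q` dominates both `cτv` and
`cτ|s|`, hence their geometric mean. This distributes the singularity over two variables, in each of
which it is integrable. Adding both roots avoids keeping track of the sign of `t`. -/
theorem inv_le_of_slice {c τ Q B t s : ℝ} (hc : 0 < c) (hc1 : c ≤ 1) (hτ : 0 < τ)
    (ht : c * τ ≤ |t|) (h1 : |B - t ^ 2| ≤ Q) (h2 : 2 * τ * |s| ≤ Q)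
    (hn1 : t ≠ √B) (hn2 : t ≠ -√B) (hs : s ≠ 0) :
    Q⁻¹ ≤ (c * τ)⁻¹ * (|t - √B| ^ (-1 / 2 : ℝ) + |t - -√B| ^ (-1 / 2 : ℝ)) *
      |s| ^ (-1 / 2 : ℝ) := by
  have hcτ : 0 < c * τ := by positivity
  have hspos : 0 < |s| := abs_pos.mpr hs
  have key : ∀ v : ℝ, 0 < v → c * τ * v ≤ Q → Q⁻¹ ≤ (c * τ)⁻¹ * (v ^ (-1 / 2 : ℝ)) *
      |s| ^ (-1 / 2 : ℝ) := fun v hv hvQ => by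
    rw [rpow_neg_half_eq_inv_sqrt hv.le, rpow_neg_half_eq_inv_sqrt hspos.le, ← mul_inv, ← mul_inv]
    have hv' := Real.sqrt_pos.mpr hv
    have hs' := Real.sqrt_pos.mpr hspos
    refine inv_anti₀ (by positivity) ?_
    have e1 : v = √v ^ 2 := (Real.sq_sqrt hv.le).symm
    have e2 : |s| = √|s| ^ 2 := (Real.sq_sqrt hspos.le).symm
    have h3 : c * τ * |s| ≤ Q := le_trans (by nlinarith [mul_pos hτ hspos]) h2
    have h4 : c * τ * (v + |s|) ≤ 2 * Q := by linarith
    have h5 : 2 * (√v * √|s|) ≤ v + |s| := by nlinarith [sq_nonneg (√v - √|s|)]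
    nlinarith
  have hm := abs_mul_abs_abs_sub_sqrt_le B t
  have n1 : 0 ≤ |t - √B| ^ (-1 / 2 : ℝ) := by positivity
  have n2 : 0 ≤ |t - -√B| ^ (-1 / 2 : ℝ) := by positivity
  have n3 : 0 ≤ |s| ^ (-1 / 2 : ℝ) := by positivity
  rcases le_total 0 t with h0 | h0
  · refine (key |t - √B| (abs_pos.mpr (sub_ne_zero.mpr hn1)) ?_).trans ?_
    · rw [abs_of_nonneg h0] at hm ht
      exact ((mul_le_mul_of_nonneg_right ht (abs_nonneg _)).trans hm).trans h1
    · gcongr; linarith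
  · refine (key |t - -√B| (abs_pos.mpr (sub_ne_zero.mpr hn2)) ?_).trans ?_
    · rw [abs_of_nonpos h0] at hm ht
      have e : |t - -√B| = |-t - √B| := by rw [← abs_neg]; congr 1; ring
      rw [e]
      exact ((mul_le_mul_of_nonneg_right ht (abs_nonneg _)).trans hm).trans h1
    · gcongr; linarith

/-! ### Convolution of the Gaussian with the inverse symbol. -/

theorem lintegral_gaussDensity_inv_qSymbol_coord_le {k : ℕ} {R τ c : ℝ} (hR : 0 < R) (hτ : 0 < τ)
    (hc : 0 < c) (hc1 : c ≤ 1) {m : Fin (k + 2)} (hm : m ≠ Fin.last (k + 1)) (ξ : Eucl (k + 2)) :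
    ∫⁻ ζ : Eucl (k + 2), ENNReal.ofReal (gaussDensity R (ξ - ζ)) *
      (if c * τ ≤ |ζ m| then ENNReal.ofReal ‖qSymbol τ ζ‖⁻¹ else 0) ≤
      ENNReal.ofReal (50 / c * (R / τ)) := by
  have hGm : ∀ {k : ℕ} (ξ : Eucl k), Measurable fun η : Eucl k =>
      ENNReal.ofReal (gaussDensity R (ξ - η)) := fun ξ =>
    ((continuous_gaussDensity R).comp (continuous_const.sub continuous_id)).measurable.ennreal_ofReal
  have hqm : Measurable fun ζ : Eucl (k + 2) =>
      (if c * τ ≤ |ζ m| then ENNReal.ofReal ‖qSymbol τ ζ‖⁻¹ else 0) := by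
    refine Measurable.ite (measurableSet_le (by fun_prop) (by fun_prop)) ?_ measurable_const
    exact ((continuous_qSymbol τ).norm.measurable.inv).ennreal_ofReal
  obtain ⟨⟨a, x⟩, rfl⟩ := (insertCoord m).surjective ξ
  -- Since `m` is not the last index, `ξ_d` survives as coordinate `j` of the remaining variable
  -- `η`.
  obtain ⟨j, hj⟩ := Fin.exists_succAbove_eq hm.symm
  rw [lintegral_insertCoord m ((hGm _).fun_mul hqm)]
  have hLm : Measurable fun t : ℝ => ENNReal.ofReal (lineGauss R (a - t)) :=
    ((continuous_lineGauss R).comp (continuous_const.sub continuous_id)).measurable.ennreal_ofReal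
  have hinner : ∀ᵐ η : Eucl (k + 1), ∫⁻ t : ℝ,
      ENNReal.ofReal (gaussDensity R (insertCoord m (a, x) - insertCoord m (t, η))) *
      (if c * τ ≤ |insertCoord m (t, η) m| then
        ENNReal.ofReal ‖qSymbol τ (insertCoord m (t, η))‖⁻¹ else 0) ≤
      ENNReal.ofReal ((c * τ)⁻¹ * (10 * √R)) * (ENNReal.ofReal (gaussDensity R (x - η)) *
        ENNReal.ofReal (|η j| ^ (-1 / 2 : ℝ))) := by
    filter_upwards [ae_coord_ne_zero j] with η hη
    set b := √(τ ^ 2 - ‖η‖ ^ 2) with hb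
    calc _ ≤ ∫⁻ t : ℝ, (ENNReal.ofReal ((c * τ)⁻¹) * (ENNReal.ofReal (gaussDensity R (x - η)) *
          ENNReal.ofReal (|η j| ^ (-1 / 2 : ℝ)))) * (ENNReal.ofReal (lineGauss R (a - t)) *
          ENNReal.ofReal (|t - b| ^ (-1 / 2 : ℝ)) + ENNReal.ofReal (lineGauss R (a - t)) *
          ENNReal.ofReal (|t - -b| ^ (-1 / 2 : ℝ))) := by
          refine lintegral_mono_ae ?_
          filter_upwards [Measure.ae_ne volume b, Measure.ae_ne volume (-b)] with t h1 h2
          simp only [gaussDensity_insertCoord_sub, insertCoord_same]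
          split_ifs with ht
          · have h3 := abs_sub_norm_sq_le_norm_qSymbol τ (insertCoord m (t, η))
            have h4 := two_mul_abs_lastCoord_le_norm_qSymbol hτ (insertCoord m (t, η))
            rw [lastCoord_succ, ← hj, insertCoord_succAbove] at h4
            rw [norm_insertCoord_sq, show τ ^ 2 - (t ^ 2 + ‖η‖ ^ 2) = τ ^ 2 - ‖η‖ ^ 2 - t ^ 2 by
              ring] at h3
            have h5 := inv_le_of_slice hc hc1 hτ ht h3 h4 h1 h2 hη
            refine (mul_le_mul_right (ENNReal.ofReal_le_ofReal h5) _).trans (le_of_eq ?_)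
            rw [ENNReal.ofReal_mul (lineGauss_nonneg hR _), ENNReal.ofReal_mul (by positivity),
              ENNReal.ofReal_mul (by positivity), ENNReal.ofReal_add (by positivity)
              (by positivity)]
            ring
          · simp
      _ ≤ _ := by
          rw [lintegral_const_mul _ (by fun_prop), lintegral_add_left (by fun_prop)]
          refine (mul_le_mul_right (add_le_add (lintegral_lineGauss_mul_rpow_le hR a b)
            (lintegral_lineGauss_mul_rpow_le hR a (-b))) _).trans (le_of_eq ?_)
          rw [← ENNReal.ofReal_add (by positivity) (by positivity),
            show 5 * √R + 5 * √R = 10 * √R by ring,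
            ENNReal.ofReal_mul (p := (c * τ)⁻¹) (by positivity)]
          ring
  refine (lintegral_mono_ae hinner).trans ?_
  rw [lintegral_const_mul' _ _ ENNReal.ofReal_ne_top]
  -- The two roots in `t` gave `10 √R`, and the variable `η j` gives `5 √R`; together with `1 /
  -- (cτ)` this is `50 / c * (R / τ)`.
  refine (mul_le_mul_right (lintegral_gaussDensity_mul_rpow_le hR j x) _).trans (le_of_eq ?_)
  rw [← ENNReal.ofReal_mul (by positivity)]
  congr 1
  have := Real.mul_self_sqrt hR.le
  field_simp
  linear_combination 50 * this

theorem lintegral_gaussDensity_small_coord_le {n : ℕ} {R δ : ℝ} (hR : 0 < R)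
    (m : Fin (n + 1)) (ξ : Eucl (n + 1)) :
    ∫⁻ ζ : Eucl (n + 1), ENNReal.ofReal (gaussDensity R (ξ - ζ)) * (if |ζ m| < δ then 1 else 0) ≤
      ENNReal.ofReal (2 * R * δ) := by
  have hGm : ∀ {k : ℕ} (ξ : Eucl k), Measurable fun η : Eucl k =>
      ENNReal.ofReal (gaussDensity R (ξ - η)) := fun ξ =>
    ((continuous_gaussDensity R).comp (continuous_const.sub continuous_id)).measurable.ennreal_ofReal
  have hm : Measurable fun ζ : Eucl (n + 1) => (if |ζ m| < δ then 1 else 0 : ℝ≥0∞) :=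
    Measurable.ite (measurableSet_lt (by fun_prop) (by fun_prop)) measurable_const measurable_const
  obtain ⟨⟨a, x⟩, rfl⟩ := (insertCoord m).surjective ξ
  rw [lintegral_insertCoord m ((hGm _).fun_mul hm)]
  calc _ ≤ ∫⁻ η : Eucl n, ENNReal.ofReal (gaussDensity R (x - η)) *
        ENNReal.ofReal (2 * R * δ) := by
        refine lintegral_mono fun η => ?_
        simp only [gaussDensity_insertCoord_sub, insertCoord_same]
        calc _ = ∫⁻ t, ENNReal.ofReal (gaussDensity R (x - η)) *
              (ENNReal.ofReal (lineGauss R (a - t)) * (if |t| < δ then 1 else 0)) := by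
              refine lintegral_congr fun t => ?_
              rw [ENNReal.ofReal_mul (lineGauss_nonneg hR _)]; ring
          _ ≤ _ := by
              rw [lintegral_const_mul' _ _ ENNReal.ofReal_ne_top]
              gcongr
              exact lintegral_lineGauss_abs_lt_le hR a
    _ = _ := by rw [lintegral_mul_const _ (hGm x), lintegral_gaussDensity_sub hR, one_mul]

/-- If `|ζ_d| ≥ τ / 2`, the imaginary part suffices. Otherwise `|ζ|² ≤ τ² / 2`, and the real part
`τ² - |ζ|²` does. -/
theorem half_sq_le_norm_qSymbol {n : ℕ} {τ c : ℝ} (hτ : 0 < τ) (hc : c ^ 2 * (n + 1) ≤ 1 / 4)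
    {ζ : Eucl (n + 1)} (hζ : ∀ m : Fin (n + 1), m ≠ Fin.last n → |ζ m| < c * τ) :
    τ ^ 2 / 2 ≤ ‖qSymbol τ ζ‖ := by
  have h1 := abs_sub_norm_sq_le_norm_qSymbol τ ζ
  have h2 := two_mul_abs_lastCoord_le_norm_qSymbol hτ ζ
  rw [lastCoord_succ] at h2
  rcases le_total (τ / 2) |ζ (Fin.last n)| with h | h
  · nlinarith
  · refine le_trans ?_ ((le_abs_self _).trans h1)
    have h3 : ‖ζ‖ ^ 2 ≤ n * (c * τ) ^ 2 + (τ / 2) ^ 2 := by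
      rw [EuclideanSpace.norm_sq_eq, Fin.sum_univ_castSucc]
      gcongr
      · calc ∑ i : Fin n, ‖ζ i.castSucc‖ ^ 2 ≤ ∑ _i : Fin n, (c * τ) ^ 2 := by
              refine Finset.sum_le_sum fun i _ => ?_
              gcongr
              exact (hζ _ (Fin.castSucc_lt_last i).ne).le
          _ = n * (c * τ) ^ 2 := by simp
      · exact h
    have h4 : n * (c * τ) ^ 2 ≤ 1 / 4 * τ ^ 2 := by
      have : c ^ 2 * n ≤ 1 / 4 := le_trans (by nlinarith [sq_nonneg c]) hc
      nlinarith [sq_nonneg τ]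
    nlinarith

theorem exists_lintegral_gaussDensity_inv_qSymbol_le (k : ℕ) :
    ∃ C : ℝ, 0 < C ∧ ∀ R τ : ℝ, 0 < R → 0 < τ → ∀ ξ : Eucl (k + 2),
      ∫⁻ ζ : Eucl (k + 2), ENNReal.ofReal (gaussDensity R (ξ - ζ)) *
        ENNReal.ofReal ‖qSymbol τ ζ‖⁻¹ ≤ ENNReal.ofReal (C * (R / τ)) := by
  -- With `d = k + 2`, this choice gives `c ≤ 1` and `c² d = 1 / (4d) ≤ 1 / 4`.
  set c : ℝ := 1 / (2 * (k + 2)) with hcdef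
  have hc : 0 < c := by positivity
  have hc1 : c ≤ 1 := by
    rw [hcdef, div_le_one (by positivity)]
    have : (0 : ℝ) ≤ k := k.cast_nonneg
    linarith
  have hc2 : c ^ 2 * (((k + 1 : ℕ) : ℝ) + 1) ≤ 1 / 4 := by
    have : (0 : ℝ) ≤ k := k.cast_nonneg
    have e : c * (k + 2) = 1 / 2 := by rw [hcdef]; field_simp
    push_cast
    have e2 : c ≤ 1 / 2 := by nlinarith
    nlinarith
  refine ⟨(k + 2) * (50 / c) + 4 * c, by positivity, fun R τ hR hτ ξ => ?_⟩
  have hGm : Measurable fun η : Eucl (k + 2) =>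
      ENNReal.ofReal (gaussDensity R (ξ - η)) :=
    ((continuous_gaussDensity R).comp (continuous_const.sub continuous_id)).measurable.ennreal_ofReal
  have hqm : ∀ m : Fin (k + 2), Measurable fun ζ : Eucl (k + 2) =>
      (if c * τ ≤ |ζ m| then ENNReal.ofReal ‖qSymbol τ ζ‖⁻¹ else 0) := fun m => by
    refine Measurable.ite (measurableSet_le (by fun_prop) (by fun_prop)) ?_ measurable_const
    exact ((continuous_qSymbol τ).norm.measurable.inv).ennreal_ofReal
  let J : Finset (Fin (k + 2)) := Finset.univ.filter (· ≠ Fin.last (k + 1))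
  -- In the exceptional region all non-last coordinates are below `cτ`. Remembering only coordinate
  -- `0` keeps a slab of Gaussian mass at most `2Rcτ`, which turns `2 / τ²` into `4cR / τ`.
  have hpt : ∀ ζ : Eucl (k + 2), ENNReal.ofReal ‖qSymbol τ ζ‖⁻¹ ≤
      (∑ m ∈ J, (if c * τ ≤ |ζ m| then ENNReal.ofReal ‖qSymbol τ ζ‖⁻¹ else 0)) +
        ENNReal.ofReal (2 / τ ^ 2) * (if |ζ 0| < c * τ then 1 else 0) := fun ζ => by
    by_cases h : ∃ m ∈ J, c * τ ≤ |ζ m|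
    · obtain ⟨m, hmJ, hm⟩ := h
      refine le_trans ?_ le_self_add
      refine le_trans (le_of_eq ?_) (Finset.single_le_sum (fun i _ => zero_le) hmJ)
      rw [if_pos hm]
    · push Not at h
      refine le_trans ?_ le_add_self
      have h0 : |ζ 0| < c * τ := h 0 (by simp [J, Fin.ext_iff])
      rw [if_pos h0, mul_one]
      refine ENNReal.ofReal_le_ofReal ?_
      have := half_sq_le_norm_qSymbol hτ hc2 (ζ := ζ) fun m hm => h m (by simpa [J] using hm)
      rw [show 2 / τ ^ 2 = (τ ^ 2 / 2)⁻¹ by rw [inv_div]]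
      exact inv_anti₀ (by positivity) this
  calc _ ≤ ∫⁻ ζ : Eucl (k + 2), ((∑ m ∈ J, ENNReal.ofReal (gaussDensity R (ξ - ζ)) *
          (if c * τ ≤ |ζ m| then ENNReal.ofReal ‖qSymbol τ ζ‖⁻¹ else 0)) +
          ENNReal.ofReal (2 / τ ^ 2) * (ENNReal.ofReal (gaussDensity R (ξ - ζ)) *
            (if |ζ 0| < c * τ then 1 else 0))) := by
        refine lintegral_mono fun ζ => ?_
        refine (mul_le_mul_right (hpt ζ) _).trans (le_of_eq ?_)
        rw [mul_add, Finset.mul_sum]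
        ring
    _ ≤ (∑ _m ∈ J, ENNReal.ofReal (50 / c * (R / τ))) +
          ENNReal.ofReal (2 / τ ^ 2) * ENNReal.ofReal (2 * R * (c * τ)) := by
        rw [lintegral_add_left (Finset.measurable_fun_sum J fun m _ => hGm.fun_mul (hqm m)),
          lintegral_finsetSum J fun m _ => hGm.fun_mul (hqm m),
          lintegral_const_mul' _ _ ENNReal.ofReal_ne_top]
        gcongr with m hm
        · exact lintegral_gaussDensity_inv_qSymbol_coord_le hR hτ hc hc1 (by simpa [J] using hm) ξ
        · exact lintegral_gaussDensity_small_coord_le hR 0 ξ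
    _ ≤ ((k + 2 : ℕ) : ℝ≥0∞) * ENNReal.ofReal (50 / c * (R / τ)) +
          ENNReal.ofReal (4 * c * (R / τ)) := by
        rw [Finset.sum_const, nsmul_eq_mul, ← ENNReal.ofReal_mul (by positivity)]
        refine add_le_add (mul_le_mul_left (Nat.cast_le.mpr
          ((Finset.card_le_univ J).trans_eq (by simp))) _) (le_of_eq ?_)
        congr 1
        field_simp
        norm_num
    _ = _ := by
        rw [← ENNReal.ofReal_natCast, ← ENNReal.ofReal_mul (by positivity),
          ← ENNReal.ofReal_add (by positivity) (by positivity)]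
        congr 1
        push_cast
        ring

/-! ### Dyadic shells and the weighted energy estimate. -/

theorem eLpNorm_two_sq {α : Type*} {mα : MeasurableSpace α} (μ : Measure α) (g : α → ℂ) :
    eLpNorm g 2 μ ^ 2 = ∫⁻ x, ‖g x‖ₑ ^ 2 ∂μ := by
  rw [eLpNorm_eq_lintegral_rpow_enorm_toReal two_ne_zero ENNReal.ofNat_ne_top,
    ← ENNReal.rpow_natCast, ← ENNReal.rpow_mul]
  simp

theorem ENNReal_le_of_sq_le_sq {a b : ℝ≥0∞} (h : a ^ 2 ≤ b ^ 2) : a ≤ b :=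
  (ENNReal.pow_le_pow_left_iff two_ne_zero).mp h

theorem measurableSet_dyadicShell (d j : ℕ) : MeasurableSet (dyadicShell d j) := by
  cases j with
  | zero => exact measurableSet_le measurable_norm measurable_const
  | succ j =>
    exact (measurableSet_lt measurable_const measurable_norm).inter
      (measurableSet_le measurable_norm measurable_const)

theorem norm_le_of_mem_dyadicShell {d j : ℕ} {x : Eucl d} (hx : x ∈ dyadicShell d j) :
    ‖x‖ ≤ (2 : ℝ) ^ j := by
  cases j with
  | zero => simpa [dyadicShell] using hx
  | succ j => exact hx.2

theorem two_pow_le_of_mem_dyadicShell {d j : ℕ} {x : Eucl d} (hx : x ∈ dyadicShell d j) :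
    (2 : ℝ) ^ j ≤ 2 * (1 + ‖x‖) := by
  cases j with
  | zero => rw [pow_zero]; linarith [norm_nonneg x]
  | succ j => rw [pow_succ]; linarith [hx.1]

theorem iUnion_dyadicShell (d : ℕ) : ⋃ j, dyadicShell d j = Set.univ := by
  refine Set.eq_univ_of_forall fun x => Set.mem_iUnion.mpr ?_
  have hex : ∃ j : ℕ, ‖x‖ ≤ (2 : ℝ) ^ j :=
    (pow_unbounded_of_one_lt ‖x‖ one_lt_two).imp fun _ h => h.le
  classical
  have hs := Nat.find_spec hex
  have hmin : ∀ i < Nat.find hex, ¬ ‖x‖ ≤ (2 : ℝ) ^ i := fun i hi => Nat.find_min hex hi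
  generalize Nat.find hex = j at hs hmin
  refine ⟨j, ?_⟩
  cases j with
  | zero => simpa [dyadicShell] using hs
  | succ j => exact ⟨not_le.mp (hmin j (Nat.lt_succ_self j)), hs⟩

theorem lintegral_le_tsum_dyadicShell {d : ℕ} (g : Eucl d → ℝ≥0∞) :
    ∫⁻ x, g x ≤ ∑' j, ∫⁻ x in dyadicShell d j, g x := by
  rw [← setLIntegral_univ, ← iUnion_dyadicShell d]
  exact lintegral_iUnion_le _ _

theorem ofReal_two_rpow_half_sq (s : ℝ) :
    ENNReal.ofReal ((2 : ℝ) ^ (s / 2)) ^ 2 = ENNReal.ofReal ((2 : ℝ) ^ s) := by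
  rw [← ENNReal.ofReal_pow (by positivity), ← Real.rpow_natCast, ← Real.rpow_mul (by norm_num)]
  congr 2; push_cast; ring

theorem tripleStar_sq_le {d : ℕ} {g : Eucl d → ℂ} {K : ℝ≥0∞}
    (h : ∀ j, ∫⁻ x in dyadicShell d j, ‖g x‖ₑ ^ 2 ≤ ENNReal.ofReal ((2 : ℝ) ^ j) * K) :
    tripleStar g ^ 2 ≤ K := by
  have hK : (K ^ (1 / 2 : ℝ)) ^ 2 = K := by
    rw [← ENNReal.rpow_natCast, ← ENNReal.rpow_mul]; simp
  rw [← hK]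
  gcongr
  refine iSup_le fun j => ENNReal_le_of_sq_le_sq ?_
  rw [hK, mul_pow, eLpNorm_two_sq, ofReal_two_rpow_half_sq]
  refine (mul_le_mul_right (h j) _).trans (le_of_eq ?_)
  rw [← mul_assoc, ← ENNReal.ofReal_mul (by positivity), Real.rpow_neg (by norm_num),
    Real.rpow_natCast, inv_mul_cancel₀ (by positivity), ENNReal.ofReal_one, one_mul]

theorem setLIntegral_dyadicShell_le {d : ℕ} (g : Eucl d → ℂ) (j : ℕ) :
    ∫⁻ x in dyadicShell d j, ‖g x‖ₑ ^ 2 ≤ ENNReal.ofReal ((2 : ℝ) ^ j) * tripleStar g ^ 2 := by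
  have h : ENNReal.ofReal ((2 : ℝ) ^ (-(j : ℝ) / 2)) *
      eLpNorm g 2 (volume.restrict (dyadicShell d j)) ≤ tripleStar g :=
    le_iSup (fun j : ℕ => ENNReal.ofReal ((2 : ℝ) ^ (-(j : ℝ) / 2)) *
      eLpNorm g 2 (volume.restrict (dyadicShell d j))) j
  have h2 := pow_le_pow_left₀ zero_le h 2
  rw [mul_pow, eLpNorm_two_sq, ofReal_two_rpow_half_sq] at h2
  refine le_trans (le_of_eq ?_) (mul_le_mul_right h2 _)
  rw [← mul_assoc, ← ENNReal.ofReal_mul (by positivity), Real.rpow_neg (by norm_num),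
    Real.rpow_natCast, mul_inv_cancel₀ (by positivity), ENNReal.ofReal_one, one_mul]

/-- The core of claims 1 and 2: the local energy bound at `R = 2^j` grows like `2^j / τ`, exactly
what the normalization of `tripleStar` absorbs. -/
theorem exists_tripleStar_fourierCheck_sq_le (k : ℕ) :
    ∃ C : ℝ, 0 < C ∧ ∀ τ : ℝ, 0 < τ → ∀ h : Eucl (k + 2) → ℂ, Integrable h →
      ENNReal.ofReal τ * tripleStar (fourierCheck h) ^ 2 ≤
        ENNReal.ofReal C * ∫⁻ ξ, ‖h ξ‖ₑ ^ 2 * ENNReal.ofReal ‖qSymbol τ ξ‖ := by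
  obtain ⟨C, hC, hk⟩ := exists_lintegral_gaussDensity_inv_qSymbol_le k
  refine ⟨Real.exp 1 * C, by positivity, fun τ hτ h hh => ?_⟩
  have hb := tripleStar_sq_le (g := fourierCheck h) (K := ENNReal.ofReal (Real.exp 1 * C / τ) *
      ∫⁻ ξ, ‖h ξ‖ₑ ^ 2 * ENNReal.ofReal ‖qSymbol τ ξ‖) fun j => by
    have hR : (0 : ℝ) < 2 ^ j := by positivity
    refine (setLIntegral_fourierCheck_le_weighted hR hh (continuous_qSymbol τ).norm.measurable
      (ae_norm_qSymbol_pos hτ) (hk _ τ hR hτ) (measurableSet_dyadicShell _ j)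
      fun x hx => norm_le_of_mem_dyadicShell hx).trans (le_of_eq ?_)
    rw [← mul_assoc, ← mul_assoc, ← ENNReal.ofReal_mul (by positivity),
      ← ENNReal.ofReal_mul (by positivity)]
    congr 2; ring
  refine (mul_le_mul_right hb _).trans (le_of_eq ?_)
  rw [← mul_assoc, ← ENNReal.ofReal_mul hτ.le]
  congr 2; field_simp

theorem yDotNorm_half_sq {d : ℕ} (τ : ℝ) (f : 𝓢(Eucl d, ℂ)) :
    yDotNorm (1 / 2) τ f ^ 2 =
      ∫⁻ ξ, ‖fourierHat f ξ‖ₑ ^ 2 * ENNReal.ofReal ‖qSymbol τ ξ‖ := by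
  rw [yDotNorm, eLpNorm_two_sq]
  refine lintegral_congr fun ξ => ?_
  rw [enorm_mul, mul_pow, mul_comm]
  congr 1
  rw [← ofReal_norm, Complex.norm_real, Real.norm_of_nonneg (by positivity),
    ← ENNReal.ofReal_pow (by positivity), ← Real.sqrt_eq_rpow, Real.sq_sqrt (norm_nonneg _)]

/-! ### Fourier inversion in the angular normalization. -/

theorem fourierHat_eq_fourier {d : ℕ} (g : Eucl d → ℂ) (ξ : Eucl d) :
    fourierHat g ξ = (((2 * Real.pi) ^ (-(d : ℝ) / 2) : ℝ) : ℂ) *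
      FourierTransform.fourier g ((2 * Real.pi)⁻¹ • ξ) := by
  rw [fourierHat, Real.fourier_eq']
  congr 2; ext x
  rw [inner_smul_right, smul_eq_mul]
  congr 2
  have : (Real.pi : ℂ) ≠ 0 := by exact_mod_cast Real.pi_ne_zero
  push_cast; field_simp

theorem fourierCheck_eq_fourierInv {d : ℕ} (g : Eucl d → ℂ) (x : Eucl d) :
    fourierCheck g x = (((2 * Real.pi) ^ ((d : ℝ) / 2) : ℝ) : ℂ) *
      FourierTransformInv.fourierInv (fun w => g ((2 * Real.pi) • w)) x := by
  have h2 : (0 : ℝ) < 2 * Real.pi := by positivity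
  rw [fourierCheck, Real.fourierInv_eq']
  have h := Measure.integral_comp_smul (volume : Measure (Eucl d))
    (fun ξ => Complex.exp (Complex.I * ((inner ℝ x ξ : ℝ) : ℂ)) * g ξ) (2 * Real.pi)
  have e : ∀ v : Eucl d, Complex.exp (((2 * Real.pi * inner ℝ v x : ℝ) : ℂ) * Complex.I) •
      g ((2 * Real.pi) • v) = Complex.exp (Complex.I * ((inner ℝ x ((2 * Real.pi) • v) : ℝ) : ℂ)) *
      g ((2 * Real.pi) • v) := fun v => by
    rw [inner_smul_right, real_inner_comm, smul_eq_mul, mul_comm Complex.I]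
  simp_rw [e]
  rw [h, finrank_euclideanSpace_fin, abs_of_pos (by positivity), Complex.real_smul, ← mul_assoc,
    ← Complex.ofReal_mul]
  congr 2
  rw [← Real.rpow_natCast, ← Real.rpow_neg h2.le, ← Real.rpow_add h2]
  congr 1; ring

theorem integrable_fourierHat {d : ℕ} (f : 𝓢(Eucl d, ℂ)) : Integrable (fourierHat f) := by
  rw [show fourierHat f = fun ξ => (((2 * Real.pi) ^ (-(d : ℝ) / 2) : ℝ) : ℂ) *
      (FourierTransform.fourier f : 𝓢(Eucl d, ℂ)) ((2 * Real.pi)⁻¹ • ξ) from funext fun ξ => by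
    rw [fourierHat_eq_fourier, SchwartzMap.fourier_coe]]
  exact ((FourierTransform.fourier f : 𝓢(Eucl d, ℂ)).integrable.comp_smul
    (by positivity)).const_mul _

theorem fourierCheck_fourierHat {d : ℕ} (f : 𝓢(Eucl d, ℂ)) : fourierCheck (fourierHat f) = f := by
  have h2 : (0 : ℝ) < 2 * Real.pi := by positivity
  ext x
  have h := congrFun (f.continuous.fourierInv_fourier_eq f.integrable (by
    rw [← SchwartzMap.fourier_coe]; exact (FourierTransform.fourier f : 𝓢(Eucl d, ℂ)).integrable)) x
  rw [fourierCheck_eq_fourierInv]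
  simp_rw [fourierHat_eq_fourier, smul_smul, inv_mul_cancel₀ h2.ne', one_smul]
  rw [Real.fourierInv_eq'] at h ⊢
  simp_rw [smul_eq_mul, mul_left_comm _ ((((2 * Real.pi) ^ (-(d : ℝ) / 2) : ℝ) : ℂ))] at h ⊢
  rw [integral_const_mul, h, ← mul_assoc, ← Complex.ofReal_mul, ← Real.rpow_add h2]
  rw [show (d : ℝ) / 2 + -(d : ℝ) / 2 = 0 by ring, Real.rpow_zero, Complex.ofReal_one, one_mul]

/-! ### Claim 2: the estimate with a Schwartz cutoff. -/

/-- One power of decay is enough: `|χ| ≤ 2M / 2^j` on the `j`-th shell, so its square beats the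
growth `2^j` of the local energy and leaves a geometric series. -/
theorem exists_eLpNorm_mul_le_tripleStar {d : ℕ} (χ : 𝓢(Eucl d, ℂ)) :
    ∃ K : ℝ, 0 < K ∧ ∀ g : Eucl d → ℂ,
      eLpNorm (fun x => χ x * g x) 2 volume ^ 2 ≤ ENNReal.ofReal K * tripleStar g ^ 2 := by
  obtain ⟨C0, hC0, h0⟩ := χ.decay 0 0
  obtain ⟨C1, hC1, h1⟩ := χ.decay 1 0
  simp only [pow_zero, one_mul, norm_iteratedFDeriv_zero, pow_one] at h0 h1
  set M := C0 + C1 with hM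
  refine ⟨8 * M ^ 2, by positivity, fun g => ?_⟩
  rw [eLpNorm_two_sq]
  refine (lintegral_le_tsum_dyadicShell _).trans ?_
  have hj : ∀ j : ℕ, ∫⁻ x in dyadicShell d j, ‖χ x * g x‖ₑ ^ 2 ≤
      ENNReal.ofReal (4 * M ^ 2) * tripleStar g ^ 2 * (2⁻¹ : ℝ≥0∞) ^ j := fun j => by
    have hx : ∀ x ∈ dyadicShell d j, ‖χ x * g x‖ₑ ^ 2 ≤
        ENNReal.ofReal (4 * M ^ 2 / (2 ^ j) ^ 2) * ‖g x‖ₑ ^ 2 := fun x hx => by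
      rw [enorm_mul, mul_pow]
      refine mul_le_mul_left ?_ _
      rw [← ofReal_norm, ← ENNReal.ofReal_pow (norm_nonneg _)]
      refine ENNReal.ofReal_le_ofReal ?_
      rw [le_div_iff₀ (by positivity), ← mul_pow, show 4 * M ^ 2 = (2 * M) ^ 2 by ring]
      refine pow_le_pow_left₀ (by positivity) ?_ 2
      have := two_pow_le_of_mem_dyadicShell hx
      have := h0 x
      have := h1 x
      nlinarith [norm_nonneg (χ x), norm_nonneg x]
    refine (setLIntegral_mono' (measurableSet_dyadicShell d j) hx).trans ?_
    rw [lintegral_const_mul' _ _ ENNReal.ofReal_ne_top]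
    refine (mul_le_mul_right (setLIntegral_dyadicShell_le g j) _).trans (le_of_eq ?_)
    rw [← mul_assoc, ← ENNReal.ofReal_mul (by positivity), mul_right_comm]
    congr 1
    rw [show (2⁻¹ : ℝ≥0∞) = ENNReal.ofReal (2⁻¹ : ℝ) by
      rw [ENNReal.ofReal_inv_of_pos two_pos, ENNReal.ofReal_ofNat],
      ← ENNReal.ofReal_pow (by positivity), ← ENNReal.ofReal_mul (by positivity)]
    congr 1
    rw [inv_pow]
    field_simp
  refine (ENNReal.tsum_le_tsum hj).trans (le_of_eq ?_)
  rw [ENNReal.tsum_mul_left, ENNReal.tsum_geometric, ENNReal.one_sub_inv_two, inv_inv,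
    show (2 : ℝ≥0∞) = ENNReal.ofReal 2 by simp, mul_right_comm,
    ← ENNReal.ofReal_mul (by positivity)]
  congr 2; ring

theorem exists_cutoff_bound (k : ℕ) (χ : 𝓢(Eucl (k + 2), ℂ)) :
    ∃ C : ℝ, 0 < C ∧ ∀ τ : ℝ, 0 < τ → ∀ f : 𝓢(Eucl (k + 2), ℂ),
      ENNReal.ofReal (τ ^ (1 / 2 : ℝ)) * eLpNorm (fun x => χ x * f x) 2 volume ≤
        ENNReal.ofReal C * yDotNorm (1 / 2) τ f := by
  obtain ⟨C, hC, h⟩ := exists_tripleStar_fourierCheck_sq_le k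
  obtain ⟨K, hK, hχ⟩ := exists_eLpNorm_mul_le_tripleStar χ
  refine ⟨√(K * C), by positivity, fun τ hτ f => ENNReal_le_of_sq_le_sq ?_⟩
  have h1 := h τ hτ _ (integrable_fourierHat f)
  rw [fourierCheck_fourierHat, ← yDotNorm_half_sq] at h1
  rw [mul_pow, mul_pow, ← ENNReal.ofReal_pow (by positivity), ← ENNReal.ofReal_pow (by positivity),
    Real.sq_sqrt (by positivity), ← Real.sqrt_eq_rpow, Real.sq_sqrt hτ.le,
    ENNReal.ofReal_mul hK.le, mul_assoc]
  calc _ ≤ ENNReal.ofReal τ * (ENNReal.ofReal K * tripleStar f ^ 2) := by gcongr; exact hχ _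
    _ = ENNReal.ofReal K * (ENNReal.ofReal τ * tripleStar f ^ 2) := by ring
    _ ≤ _ := by gcongr

/-! ### Integrability of the quotient by the symbol. -/

theorem norm_fourierHat_le {d : ℕ} (g : Eucl d → ℂ) (ξ : Eucl d) :
    ‖fourierHat g ξ‖ ≤ (2 * Real.pi) ^ (-(d : ℝ) / 2) * ∫ x, ‖g x‖ := by
  rw [fourierHat, norm_mul, Complex.norm_real, Real.norm_of_nonneg (by positivity)]
  gcongr
  refine (norm_integral_le_integral_norm _).trans (le_of_eq ?_)
  simp_rw [norm_mul, norm_cexp_neg_I_mul_ofReal, one_mul]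

/-- Where `|q_τ| ≥ 1` the quotient is dominated by the transform of `f`. Where `|q_τ| ≤ 1`, `ξ`
stays in a ball on which the unit Gaussian is bounded below, so the convolution bound at the origin
gives local integrability of `1 / |q_τ|`. -/
theorem integrable_fourierHat_div_qSymbol {k : ℕ} {τ : ℝ} (hτ : 0 < τ) (f : 𝓢(Eucl (k + 2), ℂ)) :
    Integrable (fun ξ : Eucl (k + 2) => fourierHat f ξ / qSymbol τ ξ) := by
  obtain ⟨C, hC, hk⟩ := exists_lintegral_gaussDensity_inv_qSymbol_le k
  have hk1 := hk 1 τ one_pos hτ 0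
  have hfi := integrable_fourierHat f
  have hqc := continuous_qSymbol (d := k + 2) τ
  refine ⟨((continuous_fourierHat f.integrable).measurable.div hqc.measurable).aestronglyMeasurable,
    ?_⟩
  set B : ℝ := (2 * Real.pi) ^ (-((k + 2 : ℕ) : ℝ) / 2) * ∫ x, ‖f x‖ with hB
  have hB0 : 0 ≤ B := by positivity
  -- The value of the unit Gaussian on `|ξ|² = τ² + 1`, a lower bound on the region `|q_τ| ≤ 1`.
  set g0 : ℝ := (1 / (2 * √Real.pi)) ^ (k + 2) * Real.exp (-((τ ^ 2 + 1) / 4)) with hg0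
  have hg0p : 0 < g0 := by positivity
  have hpt : ∀ ξ : Eucl (k + 2), ‖fourierHat f ξ / qSymbol τ ξ‖ₑ ≤ ‖fourierHat f ξ‖ₑ +
      ENNReal.ofReal (B / g0) * (ENNReal.ofReal (gaussDensity 1 (0 - ξ)) *
        ENNReal.ofReal ‖qSymbol τ ξ‖⁻¹) := fun ξ => by
    rw [← ofReal_norm, norm_div]
    rcases le_total 1 ‖qSymbol τ ξ‖ with h | h
    · refine le_trans ?_ le_self_add
      rw [← ofReal_norm]
      exact ENNReal.ofReal_le_ofReal (div_le_self (norm_nonneg _) h)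
    · refine le_trans ?_ le_add_self
      have hG := gaussDensity_nonneg one_pos (0 - ξ)
      rw [← ENNReal.ofReal_mul hG, ← ENNReal.ofReal_mul (by positivity)]
      refine ENNReal.ofReal_le_ofReal ?_
      rw [div_eq_mul_inv, ← mul_assoc]
      refine mul_le_mul_of_nonneg_right ?_ (by positivity)
      refine (norm_fourierHat_le f ξ).trans ?_
      rw [← hB, div_mul_eq_mul_div, le_div_iff₀ hg0p]
      refine mul_le_mul_of_nonneg_left ?_ hB0
      rw [hg0, gaussDensity]
      refine mul_le_mul_of_nonneg_left (Real.exp_le_exp.mpr ?_) (by positivity)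
      have h1 := (neg_le_abs _).trans ((abs_sub_norm_sq_le_norm_qSymbol τ ξ).trans h)
      rw [zero_sub, norm_neg]
      linarith
  refine lt_of_le_of_lt (lintegral_mono hpt) ?_
  rw [lintegral_add_left' hfi.1.enorm, lintegral_const_mul' _ _ ENNReal.ofReal_ne_top]
  exact ENNReal.add_lt_top.mpr ⟨hfi.2, ENNReal.mul_lt_top ENNReal.ofReal_lt_top
    (hk1.trans_lt ENNReal.ofReal_lt_top)⟩

/-! ### Claim 1: Littlewood–Paley pieces. -/

/-- Nonvanishing requires `2^(k-1) < |ξ| ≤ 2^(k+1)`, which leaves two consecutive values of `k`. At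
`ξ = 0` the two values of `φ` cancel for every `k`. -/
theorem lpPsi_eq_zero {d : ℕ} {φ : 𝓢(Eucl d, ℂ)} (hφ : IsLPBase φ) {k : ℤ} {ξ : Eucl d}
    (hk : k ∉ Finset.Icc (Int.clog 2 ‖ξ‖ - 1) (Int.clog 2 ‖ξ‖)) :
    lpPsi φ (((2 : ℝ) ^ k)⁻¹ • ξ) = 0 := by
  have h2k : (0 : ℝ) < 2 ^ k := by positivity
  have hn : ‖((2 : ℝ) ^ k)⁻¹ • ξ‖ = ‖ξ‖ / 2 ^ k := by
    rw [norm_smul, norm_inv, Real.norm_of_nonneg h2k.le, div_eq_inv_mul]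
  have hn2 : ‖(2 : ℝ) • ((2 : ℝ) ^ k)⁻¹ • ξ‖ = 2 * (‖ξ‖ / 2 ^ k) := by
    rw [norm_smul, hn]; norm_num
  rw [lpPsi]
  by_cases h1 : ‖ξ‖ ≤ 2 ^ (k - 1)
  · have h3 : 2 * (‖ξ‖ / 2 ^ k) ≤ 1 := by
      rw [zpow_sub_one₀ two_ne_zero] at h1
      rw [← mul_div_assoc, div_le_one h2k]; linarith
    have h4 : 0 ≤ ‖ξ‖ / 2 ^ k := by positivity
    rw [hφ.eq_one _ (by rw [hn]; linarith), hφ.eq_one _ (by rw [hn2]; exact h3), sub_self]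
  · by_cases h3 : 2 ^ (k + 1) < ‖ξ‖
    · have h4 : 2 < ‖ξ‖ / 2 ^ k := by
        rw [zpow_add_one₀ two_ne_zero] at h3
        rw [lt_div_iff₀ h2k]; linarith
      rw [hφ.support_subset _ (by rw [hn]; exact h4),
        hφ.support_subset _ (by rw [hn2]; linarith), sub_self]
    · exfalso
      push Not at h1 h3
      have h0 : 0 < ‖ξ‖ := lt_trans (by positivity) h1
      have c1 := Int.zpow_pred_clog_lt_self (b := 2) (by norm_num) h0
      have c2 := Int.self_le_zpow_clog (b := 2) (by norm_num) ‖ξ‖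
      push_cast at c1 c2
      have l1 := (zpow_lt_zpow_iff_right₀ (one_lt_two (α := ℝ))).mp (lt_of_lt_of_le h1 c2)
      have l2 := (zpow_lt_zpow_iff_right₀ (one_lt_two (α := ℝ))).mp (lt_of_lt_of_le c1 h3)
      exact hk (Finset.mem_Icc.mpr ⟨by linarith, by linarith⟩)

theorem exists_norm_schwartz_le {d : ℕ} (φ : 𝓢(Eucl d, ℂ)) : ∃ M : ℝ, 0 < M ∧ ∀ ξ, ‖φ ξ‖ ≤ M := by
  obtain ⟨M, hM, h⟩ := φ.decay 0 0
  exact ⟨M, hM, by simpa using h⟩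

theorem norm_lpPsi_le {d : ℕ} {φ : 𝓢(Eucl d, ℂ)} {M : ℝ} (hM : ∀ ξ, ‖φ ξ‖ ≤ M) (ξ : Eucl d) :
    ‖lpPsi φ ξ‖ ≤ 2 * M := by
  refine (norm_sub_le _ _).trans ?_
  linarith [hM ξ, hM ((2 : ℝ) • ξ)]

theorem enorm_sq_le_of_norm_le {z : ℂ} {M : ℝ} (h : ‖z‖ ≤ M) : ‖z‖ₑ ^ 2 ≤ ENNReal.ofReal (M ^ 2) := by
  rw [← ofReal_norm, ← ENNReal.ofReal_pow (norm_nonneg _)]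
  gcongr

theorem tsum_enorm_lpPsi_sq_le {d : ℕ} {φ : 𝓢(Eucl d, ℂ)} (hφ : IsLPBase φ) {M : ℝ}
    (hM : ∀ ξ, ‖φ ξ‖ ≤ M) (ξ : Eucl d) :
    ∑' k : ℤ, ‖lpPsi φ (((2 : ℝ) ^ k)⁻¹ • ξ)‖ₑ ^ 2 ≤ ENNReal.ofReal (8 * M ^ 2) := by
  rw [tsum_eq_sum (s := Finset.Icc (Int.clog 2 ‖ξ‖ - 1) (Int.clog 2 ‖ξ‖)) fun k hk => by
    rw [lpPsi_eq_zero hφ hk]; simp]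
  refine (Finset.sum_le_card_nsmul _ _ (ENNReal.ofReal ((2 * M) ^ 2)) fun k _ =>
    enorm_sq_le_of_norm_le (norm_lpPsi_le hM _)).trans (le_of_eq ?_)
  rw [Int.card_Icc, show (Int.clog 2 ‖ξ‖ + 1 - (Int.clog 2 ‖ξ‖ - 1)).toNat = 2 by
    rw [show Int.clog 2 ‖ξ‖ + 1 - (Int.clog 2 ‖ξ‖ - 1) = 2 by ring]; rfl, nsmul_eq_mul,
    ← ENNReal.ofReal_natCast, ← ENNReal.ofReal_mul (by positivity)]
  congr 1; push_cast; ring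

theorem continuous_lpPsi {d : ℕ} (φ : 𝓢(Eucl d, ℂ)) : Continuous (lpPsi φ) := by
  have := φ.continuous
  unfold lpPsi
  fun_prop

theorem enorm_sqrt_mSymbol_mul_sq_le {d : ℕ} (τ : ℝ) (ξ : Eucl d) (a b : ℂ) :
    ‖((√(mSymbol (τ ^ 2) ξ) : ℝ) : ℂ) * (a * b)‖ₑ ^ 2 ≤
      ‖a‖ₑ ^ 2 * (‖b‖ₑ ^ 2 * ENNReal.ofReal ‖qSymbol τ ξ‖) := by
  rw [enorm_mul, enorm_mul, mul_pow, mul_pow, mul_comm, mul_assoc]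
  gcongr
  rw [← ofReal_norm, Complex.norm_real, Real.norm_of_nonneg (Real.sqrt_nonneg _),
    ← ENNReal.ofReal_pow (by positivity), mSymbol, Real.sq_sqrt (abs_nonneg _)]
  exact ENNReal.ofReal_le_ofReal (abs_sub_norm_sq_le_norm_qSymbol τ ξ)

theorem eLpNorm_lpLowHat_sq_le {d : ℕ} {φ : 𝓢(Eucl d, ℂ)} {M : ℝ} (hM : ∀ ξ, ‖φ ξ‖ ≤ M)
    (τ : ℝ) (k : ℤ) (f : 𝓢(Eucl d, ℂ)) :
    eLpNorm (fun ξ => ((√(mSymbol (τ ^ 2) ξ) : ℝ) : ℂ) * lpLowHat φ k f ξ) 2 volume ^ 2 ≤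
      ENNReal.ofReal (M ^ 2) * yDotNorm (1 / 2) τ f ^ 2 := by
  rw [eLpNorm_two_sq, yDotNorm_half_sq, ← lintegral_const_mul' _ _ ENNReal.ofReal_ne_top]
  refine lintegral_mono fun ξ => ?_
  refine (enorm_sqrt_mSymbol_mul_sq_le τ ξ _ _).trans ?_
  gcongr
  exact enorm_sq_le_of_norm_le (hM _)

theorem tsum_eLpNorm_lpHat_sq_le {d : ℕ} {φ : 𝓢(Eucl d, ℂ)} (hφ : IsLPBase φ) {M : ℝ}
    (hM : ∀ ξ, ‖φ ξ‖ ≤ M) (τ : ℝ) (k₀ : ℤ) (f : 𝓢(Eucl d, ℂ)) :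
    ∑' k : Set.Ioi k₀,
        eLpNorm (fun ξ => ((√(mSymbol (τ ^ 2) ξ) : ℝ) : ℂ) * lpHat φ (k : ℤ) f ξ) 2 volume ^ 2 ≤
      ENNReal.ofReal (8 * M ^ 2) * yDotNorm (1 / 2) τ f ^ 2 := by
  have hfm : Measurable (fourierHat f) := (continuous_fourierHat f.integrable).measurable
  have hqm : Measurable fun ξ : Eucl d => ENNReal.ofReal ‖qSymbol τ ξ‖ :=
    (continuous_qSymbol τ).norm.measurable.ennreal_ofReal
  have hψ := continuous_lpPsi φ
  calc _ ≤ ∑' k : Set.Ioi k₀, ∫⁻ ξ, ‖lpPsi φ (((2 : ℝ) ^ (k : ℤ))⁻¹ • ξ)‖ₑ ^ 2 *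
        (‖fourierHat f ξ‖ₑ ^ 2 * ENNReal.ofReal ‖qSymbol τ ξ‖) := by
        refine ENNReal.tsum_le_tsum fun k => ?_
        rw [eLpNorm_two_sq]
        exact lintegral_mono fun ξ => enorm_sqrt_mSymbol_mul_sq_le τ ξ _ _
    _ ≤ ∑' k : ℤ, ∫⁻ ξ, ‖lpPsi φ (((2 : ℝ) ^ k)⁻¹ • ξ)‖ₑ ^ 2 *
        (‖fourierHat f ξ‖ₑ ^ 2 * ENNReal.ofReal ‖qSymbol τ ξ‖) :=
        ENNReal.tsum_comp_le_tsum_of_injective Subtype.val_injective _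
    _ = ∫⁻ ξ, ∑' k : ℤ, ‖lpPsi φ (((2 : ℝ) ^ k)⁻¹ • ξ)‖ₑ ^ 2 *
        (‖fourierHat f ξ‖ₑ ^ 2 * ENNReal.ofReal ‖qSymbol τ ξ‖) := by
        rw [lintegral_tsum]
        intro k
        have : Measurable fun ξ : Eucl d => lpPsi φ (((2 : ℝ) ^ k)⁻¹ • ξ) :=
          Continuous.measurable (by fun_prop)
        fun_prop
    _ ≤ _ := by
        rw [yDotNorm_half_sq, ← lintegral_const_mul' _ _ ENNReal.ofReal_ne_top]
        refine lintegral_mono fun ξ => ?_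
        rw [ENNReal.tsum_mul_right]
        gcongr
        exact tsum_enorm_lpPsi_sq_le hφ hM ξ

theorem integrable_lpHat {d : ℕ} (φ : 𝓢(Eucl d, ℂ)) (k : ℤ) (f : 𝓢(Eucl d, ℂ)) :
    Integrable (lpHat φ k f) := by
  obtain ⟨M, _, hM⟩ := exists_norm_schwartz_le φ
  have hψ := continuous_lpPsi φ
  exact (integrable_fourierHat f).bdd_mul (c := 2 * M)
    (Continuous.aestronglyMeasurable (by fun_prop))
    (Filter.Eventually.of_forall fun ξ => norm_lpPsi_le hM _)

theorem exists_yStarNorm_le (k : ℕ) {φ : 𝓢(Eucl (k + 2), ℂ)} (hφ : IsLPBase φ) :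
    ∃ C : ℝ, 0 < C ∧ ∀ τ : ℝ, 0 < τ → ∀ f : 𝓢(Eucl (k + 2), ℂ),
      yStarNorm φ (τ ^ 2) f ≤ ENNReal.ofReal C * yDotNorm (1 / 2) τ f := by
  obtain ⟨M, hM0, hM⟩ := exists_norm_schwartz_le φ
  obtain ⟨C, hC, h⟩ := exists_tripleStar_fourierCheck_sq_le k
  -- The summands belong to the low frequencies, the four critical scales, and the high frequencies,
  -- where two overlapping pieces cost `2 (2M)²`.
  refine ⟨√(M ^ 2 + 4 * (C * (2 * M) ^ 2) + 8 * M ^ 2), by positivity, fun τ hτ f =>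
    ENNReal_le_of_sq_le_sq ?_⟩
  rw [yStarNorm, ← ENNReal.rpow_natCast, ← ENNReal.rpow_mul, mul_pow,
    ← ENNReal.ofReal_pow (by positivity), Real.sq_sqrt (by positivity),
    ENNReal.ofReal_add (by positivity) (by positivity),
    ENNReal.ofReal_add (by positivity) (by positivity), add_mul, add_mul]
  norm_num only [Nat.cast_ofNat, one_div, inv_mul_cancel₀, ENNReal.rpow_one]
  refine add_le_add (add_le_add (by simpa using eLpNorm_lpLowHat_sq_le hM τ _ f) ?_)
    (by simpa using tsum_eLpNorm_lpHat_sq_le hφ hM τ _ f)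
  have hterm : ∀ l : ℤ, ENNReal.ofReal (√(τ ^ 2)) * tripleStar (lpProj φ l f) ^ 2 ≤
      ENNReal.ofReal (C * (2 * M) ^ 2) * yDotNorm (1 / 2) τ f ^ 2 := fun l => by
    rw [Real.sqrt_sq hτ.le]
    refine (h τ hτ _ (integrable_lpHat φ l f)).trans ?_
    rw [yDotNorm_half_sq, ENNReal.ofReal_mul hC.le, mul_assoc]
    refine mul_le_mul_right ?_ _
    rw [← lintegral_const_mul' _ _ ENNReal.ofReal_ne_top]
    refine lintegral_mono fun ξ => ?_
    rw [lpHat, enorm_mul, mul_pow, mul_assoc]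
    gcongr
    exact enorm_sq_le_of_norm_le (norm_lpPsi_le hM _)
  refine (Finset.sum_le_card_nsmul _ _ _ fun l _ => hterm l).trans (le_of_eq ?_)
  rw [Int.card_Icc, show (critScale (τ ^ 2) + 1 + 1 - (critScale (τ ^ 2) - 2)).toNat = 4 by
    rw [show critScale (τ ^ 2) + 1 + 1 - (critScale (τ ^ 2) - 2) = 4 by ring]; rfl, nsmul_eq_mul,
    ← mul_assoc, ← ENNReal.ofReal_natCast, ← ENNReal.ofReal_mul (by positivity)]
  simp

/-! ### One-dimensional kernels. -/

theorem integrable_inv_sub_sq {w : ℂ} (hw : w.im ≠ 0) :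
    Integrable (fun t : ℝ => (w - ((t : ℂ)) ^ 2)⁻¹) := by
  have hne : ∀ t : ℝ, w - (t : ℂ) ^ 2 ≠ 0 := fun t h => hw (by
    have := congrArg Complex.im h
    rw [Complex.sub_im, ← Complex.ofReal_pow, Complex.ofReal_im] at this
    simpa using this)
  have hδ : 0 < |w.im| := abs_pos.mpr hw
  refine (integrable_inv_one_add_sq.const_mul (1 + (1 + ‖w‖) / |w.im|)).mono' ?_ ?_
  · exact Continuous.aestronglyMeasurable (Continuous.inv₀ (by fun_prop) hne)
  · refine Filter.Eventually.of_forall fun t => ?_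
    have hpos := norm_pos_iff.mpr (hne t)
    rw [norm_inv, ← div_eq_mul_inv, le_div_iff₀ (by positivity), inv_mul_le_iff₀ hpos]
    have h1 : |w.im| ≤ ‖w - (t : ℂ) ^ 2‖ := by
      have := Complex.abs_im_le_norm (w - (t : ℂ) ^ 2)
      rwa [Complex.sub_im, ← Complex.ofReal_pow, Complex.ofReal_im, sub_zero,
        Complex.ofReal_pow] at this
    have h2 : t ^ 2 - ‖w‖ ≤ ‖w - (t : ℂ) ^ 2‖ := by
      have := norm_sub_norm_le ((t : ℂ) ^ 2) w
      rw [norm_sub_rev, norm_pow, Complex.norm_real, Real.norm_eq_abs, sq_abs] at this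
      exact this
    -- Write `1 + t² = (t² - |w|) + (1 + |w|)`: `h2` controls the first term, and the bound below by
    -- `|Im w|` controls the second.
    have h3 : 1 + ‖w‖ ≤ ‖w - (t : ℂ) ^ 2‖ * ((1 + ‖w‖) / |w.im|) := by
      rw [mul_div_assoc', le_div_iff₀ hδ, mul_comm]
      gcongr
    linarith

/-- The root in the upper half-plane makes `exp (iz|y|)` decay. -/
theorem exists_sq_eq_im_pos {w : ℂ} (hw : w.im ≠ 0) : ∃ z : ℂ, z ^ 2 = w ∧ 0 < z.im := by
  obtain ⟨z, hz⟩ := IsAlgClosed.exists_pow_nat_eq w two_pos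
  have h0 : z.im ≠ 0 := fun h => hw (by rw [← hz, sq, Complex.mul_im, h]; ring)
  rcases lt_or_gt_of_ne h0 with h | h
  · exact ⟨-z, by rw [neg_sq, hz], by rw [Complex.neg_im]; linarith⟩
  · exact ⟨z, hz, h⟩

theorem fourier_cexp_abs {z : ℂ} (hz : 0 < z.im) :
    Integrable (fun y : ℝ => Complex.exp (Complex.I * z * (|y| : ℝ))) ∧
    ∀ s : ℝ, FourierTransform.fourier (fun y : ℝ => Complex.exp (Complex.I * z * (|y| : ℝ))) s =
      2 * Complex.I * z * (z ^ 2 - ((2 * Real.pi * s : ℝ) : ℂ) ^ 2)⁻¹ := by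
  have pos : ∀ t : ℝ, (Complex.I * (z - t)).re < 0 := fun t => by simpa using hz
  have neg : ∀ t : ℝ, 0 < (-(Complex.I * (z + t))).re := fun t => by simpa using hz
  have e1 : ∀ t y : ℝ, y ∈ Set.Ioi (0 : ℝ) → Complex.exp (Complex.I * z * (|y| : ℝ)) *
      Complex.exp (-Complex.I * (t * y)) = Complex.exp (Complex.I * (z - t) * y) :=
    fun t y hy => by
      rw [abs_of_pos hy, ← Complex.exp_add]; congr 1; ring
  have e2 : ∀ t y : ℝ, y ∈ Set.Iic (0 : ℝ) → Complex.exp (Complex.I * z * (|y| : ℝ)) *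
      Complex.exp (-Complex.I * (t * y)) = Complex.exp (-(Complex.I * (z + t)) * y) :=
    fun t y hy => by
      rw [abs_of_nonpos hy, ← Complex.exp_add]; congr 1; push_cast; ring
  have i1 : ∀ t : ℝ, IntegrableOn (fun y : ℝ => Complex.exp (Complex.I * z * (|y| : ℝ)) *
      Complex.exp (-Complex.I * (t * y))) (Set.Ioi 0) := fun t =>
    (integrableOn_exp_mul_complex_Ioi (pos t) 0).congr_fun (fun y hy => (e1 t y hy).symm)
      measurableSet_Ioi
  have i2 : ∀ t : ℝ, IntegrableOn (fun y : ℝ => Complex.exp (Complex.I * z * (|y| : ℝ)) *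
      Complex.exp (-Complex.I * (t * y))) (Set.Iic 0) := fun t =>
    (integrableOn_exp_mul_complex_Iic (neg t) 0).congr_fun (fun y hy => (e2 t y hy).symm)
      measurableSet_Iic
  constructor
  · have := (i2 0).union (i1 0)
    rw [Set.Iic_union_Ioi, integrableOn_univ] at this
    simpa using this
  · intro s
    set t : ℝ := 2 * Real.pi * s with ht
    rw [Real.fourier_eq']
    have e : ∀ y : ℝ, Complex.exp (((-2 * Real.pi * inner ℝ y s : ℝ) : ℂ) * Complex.I) •
        Complex.exp (Complex.I * z * (|y| : ℝ)) = Complex.exp (Complex.I * z * (|y| : ℝ)) *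
        Complex.exp (-Complex.I * (t * y)) := fun y => by
      rw [smul_eq_mul, mul_comm]
      congr 2
      rw [ht]
      simp only [RCLike.inner_apply, conj_trivial]
      push_cast; ring
    simp_rw [e]
    rw [← intervalIntegral.integral_Iic_add_Ioi (i2 t) (i1 t),
      setIntegral_congr_fun measurableSet_Iic (e2 t),
      setIntegral_congr_fun measurableSet_Ioi (e1 t), integral_exp_mul_complex_Iic (neg t),
      integral_exp_mul_complex_Ioi (pos t)]
    have n1 : z - (t : ℂ) ≠ 0 := fun h => by
      have := congrArg Complex.im h; simp at this; exact hz.ne' this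
    have n2 : z + (t : ℂ) ≠ 0 := fun h => by
      have := congrArg Complex.im h; simp at this; exact hz.ne' this
    have n3 : z ^ 2 - (t : ℂ) ^ 2 ≠ 0 := by
      rw [sq_sub_sq]; exact mul_ne_zero n2 n1
    simp only [Complex.ofReal_zero, mul_zero, Complex.exp_zero]
    rw [sq_sub_sq] at n3 ⊢
    field_simp
    rw [Complex.I_sq]
    ring

/-- With `z² = w` and `Im z > 0`, inverting the transform of `exp (iz|y|)` identifies the integral
as `π exp (iz|x|) / (iz)`, of modulus at most `π / |z|`. -/
theorem norm_integral_cexp_mul_inv_sub_sq_le {w : ℂ} (hw : w.im ≠ 0) (x : ℝ) :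
    ‖∫ t : ℝ, Complex.exp (Complex.I * ((x * t : ℝ) : ℂ)) * (w - (t : ℂ) ^ 2)⁻¹‖ ≤
      Real.pi / √‖w‖ := by
  obtain ⟨z, rfl, hz⟩ := exists_sq_eq_im_pos hw
  obtain ⟨hi, hF⟩ := fourier_cexp_abs hz
  have h2 : (0 : ℝ) < 2 * Real.pi := by positivity
  have hz0 : z ≠ 0 := fun h => by rw [h] at hz; simp at hz
  have hcont : Continuous (fun y : ℝ => Complex.exp (Complex.I * z * (|y| : ℝ))) := by fun_prop
  have hFi : Integrable (FourierTransform.fourier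
      (fun y : ℝ => Complex.exp (Complex.I * z * (|y| : ℝ)))) := by
    rw [show FourierTransform.fourier (fun y : ℝ => Complex.exp (Complex.I * z * (|y| : ℝ))) = _ from
      funext hF]
    exact ((integrable_inv_sub_sq hw).comp_mul_left' h2.ne').const_mul _
  have h := congrFun (hcont.fourierInv_fourier_eq hi hFi) x
  rw [Real.fourierInv_eq'] at h
  have e : ∀ s : ℝ, Complex.exp (((2 * Real.pi * inner ℝ s x : ℝ) : ℂ) * Complex.I) •
      FourierTransform.fourier (fun y : ℝ => Complex.exp (Complex.I * z * (|y| : ℝ))) s =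
      2 * Complex.I * z * (fun t : ℝ => Complex.exp (Complex.I * ((x * t : ℝ) : ℂ)) *
        (z ^ 2 - (t : ℂ) ^ 2)⁻¹) (2 * Real.pi * s) := fun s => by
    rw [hF, smul_eq_mul, mul_left_comm]
    congr 3
    simp only [RCLike.inner_apply, conj_trivial]
    push_cast; ring
  simp_rw [e] at h
  have hcv := Measure.integral_comp_mul_left (fun t : ℝ =>
    Complex.exp (Complex.I * ((x * t : ℝ) : ℂ)) * (z ^ 2 - (t : ℂ) ^ 2)⁻¹) (2 * Real.pi)
  rw [integral_const_mul, hcv] at h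
  set J := ∫ t : ℝ, Complex.exp (Complex.I * ((x * t : ℝ) : ℂ)) * (z ^ 2 - (t : ℂ) ^ 2)⁻¹
  have hn := congrArg norm h
  have hle : ‖Complex.exp (Complex.I * z * (|x| : ℝ))‖ ≤ 1 := by
    rw [Complex.norm_exp, Real.exp_le_one_iff]
    have : (Complex.I * z * (|x| : ℝ)).re = -(z.im * |x|) := by simp
    rw [this]
    have := mul_nonneg hz.le (abs_nonneg x)
    linarith
  rw [norm_mul, norm_mul, norm_mul, Complex.norm_I, norm_smul, Real.norm_eq_abs, abs_abs,
    abs_of_pos (inv_pos.mpr h2), Complex.norm_ofNat] at hn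
  have hzn := norm_pos_iff.mpr hz0
  rw [norm_pow, Real.sqrt_sq hzn.le, le_div_iff₀ hzn]
  rw [← hn] at hle
  have e3 : 2 * 1 * ‖z‖ * ((2 * Real.pi)⁻¹ * ‖J‖) = ‖J‖ * ‖z‖ / Real.pi := by field_simp
  rw [e3, div_le_one Real.pi_pos] at hle
  exact hle

theorem integrable_inv_sq_add {p : ℝ} (hp : 0 < p) : Integrable (fun t : ℝ => (t ^ 2 + p)⁻¹) ∧
    ∫ t : ℝ, (t ^ 2 + p)⁻¹ = Real.pi / √p := by
  have hs := Real.sqrt_pos.mpr hp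
  have e : ∀ t : ℝ, (t ^ 2 + p)⁻¹ = p⁻¹ * (1 + ((√p)⁻¹ * t) ^ 2)⁻¹ := fun t => by
    rw [← mul_inv, mul_pow, inv_pow, Real.sq_sqrt hp.le]
    congr 1
    field_simp
    ring
  simp_rw [e]
  refine ⟨(integrable_inv_one_add_sq.comp_mul_left' (inv_ne_zero hs.ne')).const_mul _, ?_⟩
  rw [integral_const_mul, Measure.integral_comp_mul_left (fun t : ℝ => (1 + t ^ 2)⁻¹),
    integral_univ_inv_one_add_sq, inv_inv, abs_of_pos hs, smul_eq_mul]
  nth_rewrite 1 [← Real.sq_sqrt hp.le]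
  field_simp

theorem norm_integral_cexp_mul_le_of_le {N : ℝ → ℂ} {p K : ℝ} (hp : 0 < p)
    (hN : ∀ t, ‖N t‖ ≤ K * (t ^ 2 + p)⁻¹) (x : ℝ) :
    ‖∫ t : ℝ, Complex.exp (Complex.I * ((x * t : ℝ) : ℂ)) * N t‖ ≤ K * (Real.pi / √p) := by
  obtain ⟨hi, he⟩ := integrable_inv_sq_add hp
  rw [← he, ← integral_const_mul]
  refine norm_integral_le_of_norm_le (hi.const_mul K) (Filter.Eventually.of_forall fun t => ?_)
  rw [norm_mul, norm_cexp_I_mul_ofReal, one_mul]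
  exact hN t

/-- The transform of `1 / (w - t²)` alone has size up to `1 / √|w|`, which blows up as `w → 0`. The
numerator `t²` cures this: partial fractions produce `w / (w - t²)`, whose transform is only
`O(√|w|)`. -/
theorem norm_integral_coord_kernel_le {τ r s : ℝ} (hτ : 0 < τ) (hs : s ≠ 0) (hsr : s ^ 2 ≤ r) {w : ℂ}
    (hre : w.re = τ ^ 2 - r) (him : w.im = 2 * τ * s) :
    Integrable (fun t : ℝ => 2 * (t : ℂ) ^ 2 / ((w - (t : ℂ) ^ 2) *
      ((t ^ 2 + (τ ^ 2 + r) : ℝ) : ℂ))) ∧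
    ∀ x : ℝ, ‖∫ t : ℝ, Complex.exp (Complex.I * ((x * t : ℝ) : ℂ)) *
      (2 * (t : ℂ) ^ 2 / ((w - (t : ℂ) ^ 2) * ((t ^ 2 + (τ ^ 2 + r) : ℝ) : ℂ)))‖ ≤
        4 * Real.pi / τ := by
  have hr : 0 ≤ r := (sq_nonneg s).trans hsr
  set p : ℝ := τ ^ 2 + r with hp
  have hp0 : 0 < p := by positivity
  have hw : w.im ≠ 0 := by rw [him]; positivity
  have hne : ∀ t : ℝ, w - (t : ℂ) ^ 2 ≠ 0 := fun t h => hw (by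
    have := congrArg Complex.im h
    rw [Complex.sub_im, ← Complex.ofReal_pow, Complex.ofReal_im] at this
    simpa using this)
  have hne2 : ∀ t : ℝ, ((t ^ 2 + p : ℝ) : ℂ) ≠ 0 := fun t => by
    exact_mod_cast (by positivity : t ^ 2 + p ≠ 0)
  obtain ⟨hpi, hpe⟩ := integrable_inv_sq_add hp0
  have hwi := integrable_inv_sub_sq hw
  have hwp : 2 * τ ^ 2 ≤ ‖w + p‖ := by
    refine le_trans ?_ (Complex.re_le_norm _)
    rw [Complex.add_re, Complex.ofReal_re, hre, hp]; linarith
  have hwp0 : w + (p : ℂ) ≠ 0 := norm_pos_iff.mp (lt_of_lt_of_le (by positivity) hwp)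
  have hpf : ∀ t : ℝ, 2 * (t : ℂ) ^ 2 / ((w - (t : ℂ) ^ 2) * ((t ^ 2 + p : ℝ) : ℂ)) =
      2 * (w + p)⁻¹ * (w * (w - (t : ℂ) ^ 2)⁻¹ - p * (((t ^ 2 + p)⁻¹ : ℝ) : ℂ)) := fun t => by
    have h1 := hne t
    have h2 := hne2 t
    push_cast at h2 ⊢
    field_simp
    ring
  have hpiC : Integrable fun t : ℝ => (((t ^ 2 + p)⁻¹ : ℝ) : ℂ) := hpi.ofReal
  refine ⟨?_, fun x => ?_⟩
  · simp_rw [hpf]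
    exact ((hwi.const_mul w).sub (hpiC.const_mul p)).const_mul _
  have hsp : √p * √p = p := Real.mul_self_sqrt hp0.le
  have hspτ : τ ≤ √p := Real.le_sqrt_of_sq_le (by rw [hp]; linarith)
  rcases lt_or_ge w.re 0 with hneg | hnn
  -- For `Re w < 0` there is no resonance: `|w - t²| ≥ t²`, so the multiplier is at most `2 / (t² +
  -- p)`.
  · refine (norm_integral_cexp_mul_le_of_le hp0 (K := 2) (fun t => ?_) x).trans ?_
    · have h1 : t ^ 2 ≤ ‖w - (t : ℂ) ^ 2‖ := by
        refine le_trans ?_ (Complex.abs_re_le_norm _)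
        rw [Complex.sub_re, ← Complex.ofReal_pow, Complex.ofReal_re]
        exact le_trans (by linarith) (neg_le_abs _)
      rw [norm_div, norm_mul, norm_mul, norm_pow, Complex.norm_real, Complex.norm_real,
        Real.norm_of_nonneg (by positivity : 0 ≤ t ^ 2 + p), Real.norm_eq_abs, sq_abs,
        Complex.norm_ofNat, ← div_div, ← div_eq_mul_inv]
      gcongr
      rw [div_le_iff₀ (norm_pos_iff.mpr (hne t))]
      linarith
    · rw [← mul_div_assoc]
      gcongr
      linarith [Real.pi_pos]
  -- For `Re w ≥ 0`, both `√|w|` and `√p` are at most `2τ`, while `|w + p| ≥ 2τ²`.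
  · have hrτ : r ≤ τ ^ 2 := by linarith
    have hsτ : |s| ≤ τ := abs_le_of_sq_le_sq (by linarith) hτ.le
    have hwn : ‖w‖ ≤ (2 * τ) ^ 2 := by
      refine (Complex.norm_le_abs_re_add_abs_im w).trans ?_
      rw [abs_of_nonneg hnn, him, abs_mul, abs_of_pos (by positivity : 0 < 2 * τ), hre]
      nlinarith
    have hwn0 : 0 < √‖w‖ := Real.sqrt_pos.mpr (norm_pos_iff.mpr fun h => hw (by rw [h]; rfl))
    have hsw : √‖w‖ ≤ 2 * τ := Real.sqrt_le_iff.mpr ⟨by positivity, hwn⟩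
    have hsp2 : √p ≤ 2 * τ := Real.sqrt_le_iff.mpr ⟨by positivity, by rw [hp]; nlinarith⟩
    have hb : ∀ {g : ℝ → ℂ}, Integrable g →
        Integrable fun t : ℝ => Complex.exp (Complex.I * ((x * t : ℝ) : ℂ)) * g t := fun hg =>
      hg.bdd_mul (c := 1) (Continuous.aestronglyMeasurable (by fun_prop))
        (Filter.Eventually.of_forall fun t => (norm_cexp_I_mul_ofReal _).le)
    have hsplit : (∫ t : ℝ, Complex.exp (Complex.I * ((x * t : ℝ) : ℂ)) *
        (2 * (t : ℂ) ^ 2 / ((w - (t : ℂ) ^ 2) * ((t ^ 2 + p : ℝ) : ℂ)))) = 2 * (w + p)⁻¹ *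
        (w * (∫ t : ℝ, Complex.exp (Complex.I * ((x * t : ℝ) : ℂ)) * (w - (t : ℂ) ^ 2)⁻¹) -
        p * ∫ t : ℝ, Complex.exp (Complex.I * ((x * t : ℝ) : ℂ)) *
          (((t ^ 2 + p)⁻¹ : ℝ) : ℂ)) := by
      rw [← integral_const_mul, ← integral_const_mul, ← integral_sub ((hb hwi).const_mul _)
        ((hb hpiC).const_mul _), ← integral_const_mul]
      refine integral_congr_ae (Filter.Eventually.of_forall fun t => ?_)
      simp only [hpf]
      ring
    have hA := norm_integral_cexp_mul_inv_sub_sq_le hw x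
    have hB := norm_integral_cexp_mul_le_of_le hp0 (K := 1)
      (N := fun t : ℝ => (((t ^ 2 + p)⁻¹ : ℝ) : ℂ)) (fun t => by
        rw [Complex.norm_real, Real.norm_of_nonneg (by positivity), one_mul]) x
    rw [hsplit, norm_mul, norm_mul, norm_inv, Complex.norm_ofNat]
    have hw2 : ‖w‖ = √‖w‖ * √‖w‖ := (Real.mul_self_sqrt (norm_nonneg _)).symm
    have hin : ‖w * (∫ t : ℝ, Complex.exp (Complex.I * ((x * t : ℝ) : ℂ)) * (w - (t : ℂ) ^ 2)⁻¹) -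
        p * ∫ t : ℝ, Complex.exp (Complex.I * ((x * t : ℝ) : ℂ)) *
          (((t ^ 2 + p)⁻¹ : ℝ) : ℂ)‖ ≤ 4 * Real.pi * τ := by
      refine (norm_sub_le _ _).trans ?_
      rw [norm_mul, norm_mul, Complex.norm_real, Real.norm_of_nonneg hp0.le]
      have h1 : ‖w‖ * (Real.pi / √‖w‖) = Real.pi * √‖w‖ := by
        nth_rewrite 1 [hw2]; field_simp
      have h2 : p * (1 * (Real.pi / √p)) = Real.pi * √p := by
        nth_rewrite 1 [← hsp]; field_simp
      calc _ ≤ ‖w‖ * (Real.pi / √‖w‖) + p * (1 * (Real.pi / √p)) := by gcongr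
        _ ≤ _ := by
          rw [h1, h2]
          nlinarith [Real.pi_pos]
    calc 2 * ‖w + p‖⁻¹ * _ ≤ 2 * (2 * τ ^ 2)⁻¹ * (4 * Real.pi * τ) := by gcongr
      _ = _ := by field_simp

/-! ### Minkowski's inequality and the mixed norm. -/

theorem lintegral_mul_le_sqrt_mul_sqrt {α : Type*} {mα : MeasurableSpace α} {μ : Measure α}
    {f g : α → ℝ≥0∞} (hf : AEMeasurable f μ) (hg : AEMeasurable g μ) :
    ∫⁻ x, f x * g x ∂μ ≤ (∫⁻ x, f x ^ 2 ∂μ) ^ (1 / 2 : ℝ) * (∫⁻ x, g x ^ 2 ∂μ) ^ (1 / 2 : ℝ) := by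
  have h := ENNReal.lintegral_mul_le_Lp_mul_Lq μ (Real.HolderConjugate.two_two) hf hg
  simpa using h

/-- Minkowski's integral inequality for the exponent `2`. -/
theorem lintegral_sq_lintegral_le {α β : Type*} {mα : MeasurableSpace α} {mβ : MeasurableSpace β}
    {μ : Measure α} {ν : Measure β} [SFinite μ] [SFinite ν] {F : α → β → ℝ≥0∞}
    (hF : Measurable (Function.uncurry F)) :
    ∫⁻ y, (∫⁻ x, F x y ∂μ) ^ 2 ∂ν ≤ (∫⁻ x, (∫⁻ y, F x y ^ 2 ∂ν) ^ (1 / 2 : ℝ) ∂μ) ^ 2 := by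
  have hFx : ∀ x, Measurable (F x) := fun x => hF.comp measurable_prodMk_left
  have hFy : ∀ y, Measurable fun x => F x y := fun y => hF.comp measurable_prodMk_right
  have hI : Measurable fun y => ∫⁻ x, F x y ∂μ := by
    exact Measurable.lintegral_prod_left' hF
  have hN : Measurable fun x => (∫⁻ y, F x y ^ 2 ∂ν) ^ (1 / 2 : ℝ) := by
    refine Measurable.pow_const ?_ _
    exact Measurable.lintegral_prod_right' (f := fun p : α × β => F p.1 p.2 ^ 2)
      (hF.pow_const 2)
  -- Expand the square as a double integral over `x` and `x'`, integrate in `y` first, and apply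
  -- Cauchy–Schwarz there.
  calc ∫⁻ y, (∫⁻ x, F x y ∂μ) ^ 2 ∂ν = ∫⁻ y, ∫⁻ x, F x y * (∫⁻ x', F x' y ∂μ) ∂μ ∂ν := by
        refine lintegral_congr fun y => ?_
        rw [lintegral_mul_const _ (hFy y), sq]
    _ = ∫⁻ x, ∫⁻ y, F x y * (∫⁻ x', F x' y ∂μ) ∂ν ∂μ := by
        rw [lintegral_lintegral_swap]
        exact ((hF.comp measurable_swap).mul (hI.comp measurable_fst)).aemeasurable
    _ = ∫⁻ x, ∫⁻ x', ∫⁻ y, F x y * F x' y ∂ν ∂μ ∂μ := by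
        refine lintegral_congr fun x => ?_
        rw [lintegral_lintegral_swap]
        · refine lintegral_congr fun y => ?_
          rw [lintegral_const_mul _ (hFy y)]
        · exact (((hFx x).comp measurable_snd).mul hF).aemeasurable
    _ ≤ ∫⁻ x, ∫⁻ x', (∫⁻ y, F x y ^ 2 ∂ν) ^ (1 / 2 : ℝ) * (∫⁻ y, F x' y ^ 2 ∂ν) ^ (1 / 2 : ℝ)
          ∂μ ∂μ :=
        lintegral_mono fun x => lintegral_mono fun x' =>
          lintegral_mul_le_sqrt_mul_sqrt (hFx x).aemeasurable (hFx x').aemeasurable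
    _ = _ := by
        simp_rw [lintegral_const_mul _ hN]
        rw [lintegral_mul_const _ hN, sq]

theorem norm_coord_le {n : ℕ} (m : Fin n) (ξ : Eucl n) : |ξ m| ≤ ‖ξ‖ := by
  simpa using PiLp.norm_apply_le ξ m

/-- The mixed norm `L¹` in the `m`-th coordinate, `L²` in the others. -/
def mixedNorm {n : ℕ} (m : Fin (n + 1)) (g : Eucl (n + 1) → ℂ) : ℝ≥0∞ :=
  ∫⁻ s : ℝ, (∫⁻ z : Eucl n, ‖g (insertCoord m (s, z))‖ₑ ^ 2) ^ (1 / 2 : ℝ)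

theorem tsum_sq_le_sq_tsum (a : ℕ → ℝ≥0∞) : ∑' j, a j ^ 2 ≤ (∑' j, a j) ^ 2 := by
  rw [sq, ← ENNReal.tsum_mul_right]
  refine ENNReal.tsum_le_tsum fun j => ?_
  rw [sq]
  exact mul_le_mul_right (ENNReal.le_tsum j) _

theorem ENNReal_rpow_half_sq (a : ℝ≥0∞) : (a ^ (1 / 2 : ℝ)) ^ 2 = a := by
  rw [← ENNReal.rpow_natCast, ← ENNReal.rpow_mul]; simp

theorem ENNReal_sq_rpow_half (a : ℝ≥0∞) : (a ^ 2) ^ (1 / 2 : ℝ) = a := by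
  rw [← ENNReal.rpow_natCast, ← ENNReal.rpow_mul]; simp

/-- Decompose each slice over shells, using that the `ℓ²` norm is at most the `ℓ¹` norm. The `l`-th
shell lies over `|s| ≤ 2^l`, an interval of length `2 * 2^l`, so Cauchy–Schwarz in `s` costs `√2 *
2^(l/2)`. -/
theorem mixedNorm_le {n : ℕ} (m : Fin (n + 1)) {g : Eucl (n + 1) → ℂ} (hg : Continuous g) :
    mixedNorm m g ≤ ENNReal.ofReal (√2) * tripleNorm g := by
  let a : ℕ → ℝ → ℝ≥0∞ := fun l s => (∫⁻ z : Eucl n, (dyadicShell (n + 1) l).indicator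
    (fun ξ => ‖g ξ‖ₑ ^ 2) (insertCoord m (s, z))) ^ (1 / 2 : ℝ)
  have hmeas : ∀ l, Measurable ((dyadicShell (n + 1) l).indicator fun ξ => ‖g ξ‖ₑ ^ 2) :=
    fun l => Measurable.indicator (by fun_prop) (measurableSet_dyadicShell _ l)
  have hmeas2 : ∀ l, Measurable fun p : ℝ × Eucl n =>
      (dyadicShell (n + 1) l).indicator (fun ξ => ‖g ξ‖ₑ ^ 2) (insertCoord m p) :=
    fun l => (hmeas l).comp (insertCoord m).measurable
  have ham : ∀ l, Measurable (a l) := fun l => by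
    refine Measurable.pow_const ?_ _
    exact Measurable.lintegral_prod_right' (hmeas2 l)
  have hpt : ∀ s : ℝ, (∫⁻ z : Eucl n, ‖g (insertCoord m (s, z))‖ₑ ^ 2) ^ (1 / 2 : ℝ) ≤
      ∑' l, a l s := fun s => by
    refine ENNReal_le_of_sq_le_sq ?_
    rw [ENNReal_rpow_half_sq]
    refine le_trans ?_ (tsum_sq_le_sq_tsum _)
    simp only [a, ENNReal_rpow_half_sq]
    rw [← lintegral_tsum (f := fun l z => (dyadicShell (n + 1) l).indicator (fun ξ => ‖g ξ‖ₑ ^ 2)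
      (insertCoord m (s, z))) fun l => ((hmeas2 l).comp measurable_prodMk_left).aemeasurable]
    refine lintegral_mono fun z => ?_
    obtain ⟨l, hl⟩ := Set.mem_iUnion.mp
      ((iUnion_dyadicShell (n + 1)).symm ▸ Set.mem_univ (insertCoord m (s, z)))
    refine le_trans (le_of_eq ?_) (ENNReal.le_tsum l)
    rw [Set.indicator_of_mem hl]
  have hl : ∀ l : ℕ, ∫⁻ s, a l s ≤ ENNReal.ofReal (√2) * (ENNReal.ofReal ((2 : ℝ) ^ ((l : ℝ) / 2)) *
      eLpNorm g 2 (volume.restrict (dyadicShell (n + 1) l))) := fun l => by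
    have hsupp : ∀ s, a l s = (Set.Icc (-(2 : ℝ) ^ l) (2 ^ l)).indicator 1 s * a l s := fun s => by
      by_cases hs : s ∈ Set.Icc (-(2 : ℝ) ^ l) (2 ^ l)
      · rw [Set.indicator_of_mem hs, Pi.one_apply, one_mul]
      · rw [Set.indicator_of_notMem hs, zero_mul]
        have : ∀ z : Eucl n, (dyadicShell (n + 1) l).indicator
            (fun ξ => ‖g ξ‖ₑ ^ 2) (insertCoord m (s, z)) = 0 := fun z => by
          refine Set.indicator_of_notMem (fun hz => hs ?_) _
          have h1 := norm_coord_le m (insertCoord m (s, z))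
          rw [insertCoord_same] at h1
          exact abs_le.mp (h1.trans (norm_le_of_mem_dyadicShell hz))
        change (∫⁻ z : Eucl n, _) ^ (1 / 2 : ℝ) = 0
        rw [lintegral_congr this, lintegral_zero, ENNReal.zero_rpow_of_pos (by norm_num)]
    rw [lintegral_congr hsupp]
    refine (lintegral_mul_le_sqrt_mul_sqrt (Measurable.aemeasurable (measurable_one.indicator
      measurableSet_Icc)) (ham l).aemeasurable).trans (le_of_eq ?_)
    have e1 : ∫⁻ s, (Set.Icc (-(2 : ℝ) ^ l) (2 ^ l)).indicator (1 : ℝ → ℝ≥0∞) s ^ 2 =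
        ENNReal.ofReal (2 * 2 ^ l) := by
      have : ∀ s, (Set.Icc (-(2 : ℝ) ^ l) (2 ^ l)).indicator (1 : ℝ → ℝ≥0∞) s ^ 2 =
          (Set.Icc (-(2 : ℝ) ^ l) (2 ^ l)).indicator (1 : ℝ → ℝ≥0∞) s := fun s => by
        by_cases hs : s ∈ Set.Icc (-(2 : ℝ) ^ l) (2 ^ l) <;> simp [hs]
      simp_rw [this]
      rw [lintegral_indicator_one measurableSet_Icc, Real.volume_Icc]
      congr 1; ring
    have e2 : ∫⁻ s, a l s ^ 2 = eLpNorm g 2 (volume.restrict (dyadicShell (n + 1) l)) ^ 2 := by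
      simp only [a, ENNReal_rpow_half_sq]
      rw [← lintegral_insertCoord' m (hmeas l), lintegral_indicator (measurableSet_dyadicShell _ l),
        eLpNorm_two_sq]
    rw [e1, e2, ENNReal_sq_rpow_half, ← mul_assoc, ← ENNReal.ofReal_mul (by positivity),
      ENNReal.ofReal_rpow_of_nonneg (by positivity) (by norm_num),
      Real.mul_rpow (by norm_num) (by positivity), ← Real.sqrt_eq_rpow, ← Real.rpow_natCast,
      ← Real.rpow_mul (by norm_num)]
    congr 4
    ring
  calc mixedNorm m g ≤ ∫⁻ s, ∑' l, a l s := lintegral_mono hpt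
    _ = ∑' l, ∫⁻ s, a l s := lintegral_tsum fun l => (ham l).aemeasurable
    _ ≤ _ := by
      rw [tripleNorm, ← ENNReal.tsum_mul_left]
      exact ENNReal.tsum_le_tsum hl

/-! ### Multipliers with bounded kernel in one coordinate. -/

theorem fourier_const_succ (n : ℕ) : (((2 * Real.pi) ^ (-((n + 1 : ℕ) : ℝ) / 2) : ℝ) : ℂ) =
    (((2 * Real.pi) ^ (-(n : ℝ) / 2) : ℝ) : ℂ) * (((2 * Real.pi) ^ (-1 / 2 : ℝ) : ℝ) : ℂ) := by
  rw [← Complex.ofReal_mul, ← Real.rpow_add (by positivity)]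
  congr 2; push_cast; ring

theorem integrable_comp_insertCoord {n : ℕ} (m : Fin (n + 1)) {g : Eucl (n + 1) → ℂ}
    (hg : Integrable g) : Integrable (fun p => g (insertCoord m p)) (volume.prod volume) :=
  (measurePreserving_insertCoord m).integrable_comp_of_integrable hg

theorem integrable_cexp_mul {α : Type*} {mα : MeasurableSpace α} {μ : Measure α} {g : α → ℂ}
    (hg : Integrable g μ) {θ : α → ℝ} (hθ : Measurable θ) :
    Integrable (fun a => Complex.exp (Complex.I * ((θ a : ℝ) : ℂ)) * g a) μ :=
  hg.bdd_mul (c := 1) (Measurable.aestronglyMeasurable (by fun_prop))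
    (Filter.Eventually.of_forall fun t => (norm_cexp_I_mul_ofReal _).le)

theorem fourierCheck_insertCoord {n : ℕ} (m : Fin (n + 1)) {g : Eucl (n + 1) → ℂ}
    (hg : Integrable g) (x : ℝ) (y : Eucl n) :
    fourierCheck g (insertCoord m (x, y)) = fourierCheck (fun η =>
      (((2 * Real.pi) ^ (-1 / 2 : ℝ) : ℝ) : ℂ) *
        ∫ t : ℝ, Complex.exp (Complex.I * ((x * t : ℝ) : ℂ)) * g (insertCoord m (t, η))) y := by
  have hi := integrable_comp_insertCoord m hg
  have hm : Measurable fun p : ℝ × Eucl n => x * p.1 + inner ℝ y p.2 :=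
    Continuous.measurable (by fun_prop)
  rw [fourierCheck, fourierCheck, ← (measurePreserving_insertCoord m).integral_comp
    (insertCoord m).measurableEmbedding, fourier_const_succ]
  simp_rw [inner_insertCoord]
  rw [integral_prod_symm _ (integrable_cexp_mul hi hm), mul_assoc]
  congr 1
  rw [← integral_const_mul]
  refine integral_congr_ae (Filter.Eventually.of_forall fun η => ?_)
  simp only
  rw [mul_left_comm]
  congr 1
  rw [← integral_const_mul]
  refine integral_congr_ae (Filter.Eventually.of_forall fun _ => ?_)
  simp only
  rw [← mul_assoc, ← Complex.exp_add]
  congr 2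
  push_cast; ring

theorem fourierHat_insertCoord {n : ℕ} (m : Fin (n + 1)) {g : Eucl (n + 1) → ℂ}
    (hg : Integrable g) (t : ℝ) (η : Eucl n) :
    fourierHat g (insertCoord m (t, η)) = (((2 * Real.pi) ^ (-1 / 2 : ℝ) : ℝ) : ℂ) *
        ∫ s : ℝ, Complex.exp (Complex.I * ((-s * t : ℝ) : ℂ)) *
          fourierHat (fun z => g (insertCoord m (s, z))) η := by
  have hi := integrable_comp_insertCoord m hg
  have hm : Measurable fun p : ℝ × Eucl n => -(p.1 * t + inner ℝ p.2 η) :=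
    Continuous.measurable (by fun_prop)
  have hii := integrable_cexp_mul hi hm
  rw [fourierHat, ← (measurePreserving_insertCoord m).integral_comp
    (insertCoord m).measurableEmbedding, fourier_const_succ]
  simp_rw [inner_insertCoord]
  simp only [Complex.ofReal_neg, mul_neg, ← neg_mul] at hii
  rw [integral_prod _ hii, mul_comm (((2 * Real.pi) ^ (-(n : ℝ) / 2) : ℝ) : ℂ), mul_assoc]
  congr 1
  rw [← integral_const_mul]
  refine integral_congr_ae (Filter.Eventually.of_forall fun s => ?_)
  simp only
  rw [fourierHat, mul_left_comm]
  congr 1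
  rw [← integral_const_mul]
  refine integral_congr_ae (Filter.Eventually.of_forall fun _ => ?_)
  simp only
  rw [← mul_assoc, ← Complex.exp_add]
  congr 2
  push_cast; ring

/-- The Fourier transform in the `m`-th coordinate of the multiplier `N` is bounded by `A`. -/
def SliceBounded {n : ℕ} (m : Fin (n + 1)) (N : Eucl (n + 1) → ℂ) (A : ℝ) : Prop :=
  ∀ᵐ η : Eucl n, Integrable (fun t : ℝ => N (insertCoord m (t, η))) ∧
    ∀ x : ℝ, ‖∫ t : ℝ, Complex.exp (Complex.I * ((x * t : ℝ) : ℂ)) *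
      N (insertCoord m (t, η))‖ ≤ A

theorem integrable_fourierHat_slice {n : ℕ} (m : Fin (n + 1)) {g : Eucl (n + 1) → ℂ}
    (hg : Integrable g) (η : Eucl n) :
    Integrable fun s : ℝ => fourierHat (fun z => g (insertCoord m (s, z))) η := by
  have hm : Measurable fun p : ℝ × Eucl n => -(inner ℝ p.2 η : ℝ) :=
    Continuous.measurable (by fun_prop)
  have hii := integrable_cexp_mul (integrable_comp_insertCoord m hg) hm
  simp only [Complex.ofReal_neg, mul_neg, ← neg_mul] at hii
  exact hii.integral_prod_left.const_mul _

theorem measurable_fourierHat_slice {n : ℕ} (m : Fin (n + 1)) {g : Eucl (n + 1) → ℂ}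
    (hg : Continuous g) :
    Measurable fun p : ℝ × Eucl n => fourierHat (fun z => g (insertCoord m (p.1, z))) p.2 := by
  have hins := continuous_insertCoord (n := n) m
  have hc : Continuous fun q : (ℝ × Eucl n) × Eucl n =>
      Complex.exp (-Complex.I * ((inner ℝ q.2 q.1.2 : ℝ) : ℂ)) *
        g (insertCoord m (q.1.1, q.2)) := by fun_prop
  exact (hc.stronglyMeasurable.integral_prod_right'.measurable).const_mul _

/-- In the coordinate `m`, the multiplier acts as convolution of its kernel at `x - s` with the
partial transform of `g` at `s`, and the kernel is at most `A`. The factor `1 / (2π)` collects two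
one-dimensional normalizations. -/
theorem enorm_slice_integral_le {n : ℕ} {m : Fin (n + 1)} {N : Eucl (n + 1) → ℂ} {A : ℝ}
    {g : Eucl (n + 1) → ℂ} (hg : Integrable g) {η : Eucl n}
    (hNi : Integrable (fun t : ℝ => N (insertCoord m (t, η))))
    (hNA : ∀ x : ℝ, ‖∫ t : ℝ, Complex.exp (Complex.I * ((x * t : ℝ) : ℂ)) *
      N (insertCoord m (t, η))‖ ≤ A) (x : ℝ) :
    ‖(((2 * Real.pi) ^ (-1 / 2 : ℝ) : ℝ) : ℂ) *
        ∫ t : ℝ, Complex.exp (Complex.I * ((x * t : ℝ) : ℂ)) *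
          (N (insertCoord m (t, η)) * fourierHat g (insertCoord m (t, η)))‖ₑ ≤
      ENNReal.ofReal (A / (2 * Real.pi)) *
        ∫⁻ s : ℝ, ‖fourierHat (fun z => g (insertCoord m (s, z))) η‖ₑ := by
  set c : ℂ := (((2 * Real.pi) ^ (-1 / 2 : ℝ) : ℝ) : ℂ) with hc
  set G : ℝ → ℂ := fun s => fourierHat (fun z => g (insertCoord m (s, z))) η with hG
  have hA : 0 ≤ A := (norm_nonneg _).trans (hNA 0)
  have hGi : Integrable G := integrable_fourierHat_slice m hg η
  have hprod := integrable_cexp_mul (θ := fun p : ℝ × ℝ => (x - p.2) * p.1)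
    (hNi.mul_prod hGi) (by fun_prop)
  have key : c * (∫ t : ℝ, Complex.exp (Complex.I * ((x * t : ℝ) : ℂ)) *
      (N (insertCoord m (t, η)) * fourierHat g (insertCoord m (t, η)))) =
      c ^ 2 * ∫ s : ℝ, (∫ t : ℝ, Complex.exp (Complex.I * (((x - s) * t : ℝ) : ℂ)) *
        N (insertCoord m (t, η))) * G s := by
    rw [sq, mul_assoc]
    congr 1
    have e : ∀ t : ℝ, Complex.exp (Complex.I * ((x * t : ℝ) : ℂ)) *
        (N (insertCoord m (t, η)) * fourierHat g (insertCoord m (t, η))) =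
        c * ∫ s : ℝ, Complex.exp (Complex.I * (((x - s) * t : ℝ) : ℂ)) *
          (N (insertCoord m (t, η)) * G s) := fun t => by
      rw [fourierHat_insertCoord m hg, ← hc, ← mul_assoc, mul_left_comm, ← integral_const_mul]
      congr 2; ext s
      rw [show ((x - s) * t : ℝ) = x * t + -s * t by ring, Complex.ofReal_add, mul_add,
        Complex.exp_add]
      ring
    simp_rw [e]
    rw [integral_const_mul]
    congr 1
    rw [integral_integral_swap hprod]
    refine integral_congr_ae (Filter.Eventually.of_forall fun s => ?_)
    simp only
    rw [← integral_mul_const]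
    congr 1; ext t; ring
  have hcsq : ‖c ^ 2‖ₑ = ENNReal.ofReal (1 / (2 * Real.pi)) := by
    rw [hc, ← Complex.ofReal_pow, ← Real.rpow_natCast, ← Real.rpow_mul (by positivity),
      ← ofReal_norm, Complex.norm_real, Real.norm_of_nonneg (by positivity)]
    congr 1
    rw [show (-1 / 2 : ℝ) * ((2 : ℕ) : ℝ) = -1 by norm_num, Real.rpow_neg_one, one_div]
  rw [key, enorm_mul, hcsq, div_eq_mul_one_div A, mul_comm A, ENNReal.ofReal_mul (by positivity),
    mul_assoc]
  refine mul_le_mul_right ((enorm_integral_le_lintegral_enorm _).trans ?_) _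
  rw [← lintegral_const_mul'' _ hGi.1.enorm]
  refine lintegral_mono fun s => ?_
  rw [enorm_mul]
  refine mul_le_mul_left ?_ _
  rw [← ofReal_norm]
  exact ENNReal.ofReal_le_ofReal (hNA _)

/-- The `L²` bound for the inverse transform passes from `y` to `η`, the kernel bound applies for
almost every `η`, Minkowski moves the `s`-integral outside, and the `L²` bound for the forward
transform returns to space. The result is uniform in `x`. -/
theorem lintegral_slice_fourierCheck_le {n : ℕ} {m : Fin (n + 1)} {N : Eucl (n + 1) → ℂ} {A : ℝ}
    (hN : SliceBounded m N A) {g : Eucl (n + 1) → ℂ} (hgc : Continuous g) (hg : Integrable g)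
    (hNg : Integrable fun ξ => N ξ * fourierHat g ξ) (x : ℝ) :
    ∫⁻ y : Eucl n, ‖fourierCheck (fun ξ => N ξ * fourierHat g ξ) (insertCoord m (x, y))‖ₑ ^ 2 ≤
      ENNReal.ofReal (A / (2 * Real.pi)) ^ 2 * mixedNorm m g ^ 2 := by
  simp_rw [fourierCheck_insertCoord m hNg]
  have hm : Measurable fun p : ℝ × Eucl n => x * p.1 := by fun_prop
  have hH := ((integrable_cexp_mul (integrable_comp_insertCoord m hNg)
    hm).integral_prod_right).const_mul (((2 * Real.pi) ^ (-1 / 2 : ℝ) : ℝ) : ℂ)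
  have hGm := measurable_fourierHat_slice m hgc
  refine (lintegral_fourierCheck_sq_le hH).trans ?_
  calc _ ≤ ∫⁻ η : Eucl n, ENNReal.ofReal (A / (2 * Real.pi)) ^ 2 *
        (∫⁻ s : ℝ, ‖fourierHat (fun z => g (insertCoord m (s, z))) η‖ₑ) ^ 2 := by
        refine lintegral_mono_ae ?_
        filter_upwards [hN] with η hη
        rw [← mul_pow]
        exact pow_le_pow_left₀ zero_le (enorm_slice_integral_le hg hη.1 hη.2 x) 2
    _ ≤ ENNReal.ofReal (A / (2 * Real.pi)) ^ 2 * (∫⁻ s : ℝ, (∫⁻ η : Eucl n,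
        ‖fourierHat (fun z => g (insertCoord m (s, z))) η‖ₑ ^ 2) ^ (1 / 2 : ℝ)) ^ 2 := by
        rw [lintegral_const_mul' _ _ (ENNReal.pow_ne_top ENNReal.ofReal_ne_top)]
        refine mul_le_mul_right ?_ _
        exact lintegral_sq_lintegral_le hGm.enorm
    _ ≤ _ := by
        gcongr
        refine lintegral_mono_ae ?_
        filter_upwards [(integrable_comp_insertCoord m hg).prod_right_ae] with s hs
        exact ENNReal.rpow_le_rpow (lintegral_fourierHat_sq_le hs) (by norm_num)

/-- The `j`-th shell lies in the slab `|x_m| ≤ 2^j`, so a slice bound uniform in `x_m` integrates to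
at most `2 * 2^j` times its value. -/
theorem tripleStar_fourierCheck_le {n : ℕ} {m : Fin (n + 1)} {N : Eucl (n + 1) → ℂ} {A : ℝ}
    (hA : 0 < A) (hN : SliceBounded m N A) {g : Eucl (n + 1) → ℂ} (hgc : Continuous g)
    (hg : Integrable g) (hNg : Integrable fun ξ => N ξ * fourierHat g ξ) :
    tripleStar (fourierCheck fun ξ => N ξ * fourierHat g ξ) ≤
      ENNReal.ofReal A * tripleNorm g := by
  refine ENNReal_le_of_sq_le_sq (tripleStar_sq_le fun j => ?_)
  set u := fourierCheck fun ξ => N ξ * fourierHat g ξ with hu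
  have huc : Continuous u := continuous_fourierCheck hNg
  set S : Set ℝ := Set.Icc (-(2 : ℝ) ^ j) (2 ^ j) with hS
  calc ∫⁻ x in dyadicShell (n + 1) j, ‖u x‖ₑ ^ 2
      = ∫⁻ x, (dyadicShell (n + 1) j).indicator (fun x => ‖u x‖ₑ ^ 2) x := by
        rw [lintegral_indicator (measurableSet_dyadicShell _ j)]
    _ = ∫⁻ s : ℝ, ∫⁻ y : Eucl n, (dyadicShell (n + 1) j).indicator (fun x => ‖u x‖ₑ ^ 2)
          (insertCoord m (s, y)) := lintegral_insertCoord' m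
            (Measurable.indicator (by fun_prop) (measurableSet_dyadicShell _ j))
    _ ≤ ∫⁻ s : ℝ, S.indicator (fun _ => ENNReal.ofReal (A / (2 * Real.pi)) ^ 2 *
          mixedNorm m g ^ 2) s := by
        refine lintegral_mono fun s => ?_
        by_cases hs : s ∈ S
        · rw [Set.indicator_of_mem hs]
          exact (lintegral_mono fun y => Set.indicator_le_self _ _ _).trans
            (lintegral_slice_fourierCheck_le hN hgc hg hNg s)
        · rw [Set.indicator_of_notMem hs]
          refine le_of_eq (lintegral_eq_zero_of_ae_eq_zero
            (Filter.Eventually.of_forall fun y => ?_))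
          refine Set.indicator_of_notMem (fun hz => hs ?_) _
          have h1 := norm_coord_le m (insertCoord m (s, y))
          rw [insertCoord_same] at h1
          exact abs_le.mp (h1.trans (norm_le_of_mem_dyadicShell hz))
    _ = ENNReal.ofReal (A / (2 * Real.pi)) ^ 2 * mixedNorm m g ^ 2 *
          ENNReal.ofReal (2 ^ j - -2 ^ j) := by
        rw [lintegral_indicator measurableSet_Icc, setLIntegral_const, Real.volume_Icc]
    _ ≤ ENNReal.ofReal (A / (2 * Real.pi)) ^ 2 * (ENNReal.ofReal (√2) * tripleNorm g) ^ 2 *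
          ENNReal.ofReal (2 ^ j - -2 ^ j) := by
        gcongr
        exact mixedNorm_le m hgc
    _ = ENNReal.ofReal ((A / (2 * Real.pi)) ^ 2 * 2 * 2 * 2 ^ j) * tripleNorm g ^ 2 := by
        rw [mul_pow, ← ENNReal.ofReal_pow (by positivity), ← ENNReal.ofReal_pow (by positivity),
          Real.sq_sqrt (by norm_num), ← mul_assoc, mul_right_comm,
          ← ENNReal.ofReal_mul (by positivity), ← ENNReal.ofReal_mul (by positivity)]
        congr 2; ring
    _ ≤ ENNReal.ofReal (2 ^ j * A ^ 2) * tripleNorm g ^ 2 := by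
        refine mul_le_mul_left (ENNReal.ofReal_le_ofReal ?_) _
        -- The two slab factors contribute `2 * 2 = 4`, which `(A / (2π))² ≤ (A / 2)²` absorbs.
        have h1 : A / (2 * Real.pi) ≤ A / 2 := by
          gcongr
          linarith [Real.pi_gt_three]
        have h2 : (A / (2 * Real.pi)) ^ 2 ≤ (A / 2) ^ 2 := by gcongr
        have h3 : (0 : ℝ) < 2 ^ j := by positivity
        nlinarith
    _ = _ := by
        rw [mul_pow, ENNReal.ofReal_mul (by positivity), ← ENNReal.ofReal_pow hA.le, mul_assoc]

/-! ### Decomposition of the inverse symbol. -/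

/-- The part of `1 / q_τ` that is regular in the `m`-th frequency coordinate. -/
def coordMultiplier {d : ℕ} (τ : ℝ) (m : Fin d) (ξ : Eucl d) : ℂ :=
  2 * ((ξ m : ℝ) : ℂ) ^ 2 / (qSymbol τ ξ * ((‖ξ‖ ^ 2 + τ ^ 2 : ℝ) : ℂ))

/-- What remains of `1 / q_τ` after the `coordMultiplier`s are removed. -/
def restMultiplier {d : ℕ} (τ : ℝ) (ξ : Eucl d) : ℂ :=
  (((‖ξ‖ ^ 2 + τ ^ 2 : ℝ) : ℂ))⁻¹ +
    2 * (lastCoord ξ : ℂ) * ((lastCoord ξ : ℂ) - Complex.I * τ) /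
      (qSymbol τ ξ * ((‖ξ‖ ^ 2 + τ ^ 2 : ℝ) : ℂ))

/-- Divide `|ξ|² + τ² = q_τ + 2 ∑_{m ≠ d} ξ_m² + 2 ξ_d (ξ_d - iτ)` by `q_τ (|ξ|² + τ²)`. -/
theorem inv_qSymbol_eq {n : ℕ} {τ : ℝ} (hτ : 0 < τ) {ξ : Eucl (n + 1)} (hq : qSymbol τ ξ ≠ 0) :
    (qSymbol τ ξ)⁻¹ = (∑ m ∈ Finset.univ.filter (· ≠ Fin.last n), coordMultiplier τ m ξ) +
      restMultiplier τ ξ := by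
  have hP : ((‖ξ‖ ^ 2 + τ ^ 2 : ℝ) : ℂ) ≠ 0 := by
    exact_mod_cast (by positivity : ‖ξ‖ ^ 2 + τ ^ 2 ≠ 0)
  have hsum : (∑ m ∈ Finset.univ.filter (· ≠ Fin.last n), ((ξ m : ℝ) : ℂ) ^ 2) =
      ((‖ξ‖ ^ 2 : ℝ) : ℂ) - (lastCoord ξ : ℂ) ^ 2 := by
    rw [Finset.filter_ne', eq_sub_iff_add_eq, lastCoord_succ,
      Finset.sum_erase_add _ _ (Finset.mem_univ _), EuclideanSpace.norm_sq_eq]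
    simp
  have hq2 : qSymbol τ ξ = -((‖ξ‖ ^ 2 : ℝ) : ℂ) + Complex.I * (2 * τ * lastCoord ξ) + τ ^ 2 := by
    rw [qSymbol]; push_cast; ring
  simp only [coordMultiplier, restMultiplier]
  rw [← Finset.sum_div, ← Finset.mul_sum, hsum]
  push_cast at hP ⊢
  field_simp
  rw [hq2]
  push_cast
  ring

theorem norm_coordMultiplier_le {d : ℕ} (τ : ℝ) (m : Fin d) (ξ : Eucl d) :
    ‖coordMultiplier τ m ξ‖ ≤ 2 * ‖(qSymbol τ ξ)⁻¹‖ := by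
  have h : ξ m ^ 2 ≤ ‖ξ‖ ^ 2 := by
    rw [← sq_abs]; exact pow_le_pow_left₀ (abs_nonneg _) (norm_coord_le m ξ) 2
  rw [coordMultiplier, norm_div, norm_mul, norm_mul, norm_pow, Complex.norm_real,
    Complex.norm_real, Real.norm_of_nonneg (by positivity : 0 ≤ ‖ξ‖ ^ 2 + τ ^ 2),
    Real.norm_eq_abs, sq_abs, Complex.norm_ofNat, norm_inv, mul_comm ‖qSymbol τ ξ‖, ← div_div,
    div_eq_mul_inv]
  refine mul_le_mul_of_nonneg_right (div_le_of_le_mul₀ (by positivity) (by norm_num) ?_)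
    (by positivity)
  nlinarith [sq_nonneg τ]

theorem abs_lastCoord_le {n : ℕ} (ξ : Eucl (n + 1)) : |lastCoord ξ| ≤ ‖ξ‖ := by
  rw [lastCoord_succ]; exact norm_coord_le _ _

theorem norm_lastCoord_sub_sq {n : ℕ} (τ : ℝ) (ξ : Eucl (n + 1)) :
    ‖(lastCoord ξ : ℂ) - Complex.I * τ‖ ^ 2 = lastCoord ξ ^ 2 + τ ^ 2 := by
  rw [← Complex.normSq_eq_norm_sq, Complex.normSq_apply]
  simp
  ring

/-- A crude bound that serves integrability only; the sharp dependence on `τ` comes from the slices.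
-/
theorem norm_restMultiplier_le {n : ℕ} {τ : ℝ} (hτ : 0 < τ) (ξ : Eucl (n + 1)) :
    ‖restMultiplier τ ξ‖ ≤ (τ ^ 2)⁻¹ + 2 * ‖(qSymbol τ ξ)⁻¹‖ := by
  have hP : 0 < ‖ξ‖ ^ 2 + τ ^ 2 := by positivity
  rw [restMultiplier]
  refine (norm_add_le _ _).trans (add_le_add ?_ ?_)
  · rw [norm_inv, Complex.norm_real, Real.norm_of_nonneg hP.le]
    exact inv_anti₀ (by positivity) (by nlinarith [sq_nonneg ‖ξ‖])
  · rw [norm_div, norm_mul, norm_mul, norm_mul, Complex.norm_real,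
      Complex.norm_real, Real.norm_of_nonneg hP.le,
      Real.norm_eq_abs, Complex.norm_ofNat, norm_inv, mul_comm ‖qSymbol τ ξ‖, ← div_div,
      div_eq_mul_inv]
    refine mul_le_mul_of_nonneg_right (div_le_of_le_mul₀ (by positivity) (by norm_num) ?_)
      (by positivity)
    have h1 := norm_lastCoord_sub_sq τ ξ
    have h2 : |lastCoord ξ| ^ 2 ≤ ‖ξ‖ ^ 2 := pow_le_pow_left₀ (abs_nonneg _) (abs_lastCoord_le ξ) 2
    have h3 := sq_abs (lastCoord ξ)
    nlinarith [sq_nonneg (|lastCoord ξ| - ‖(lastCoord ξ : ℂ) - Complex.I * τ‖), sq_nonneg τ]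

theorem measurable_coordMultiplier {d : ℕ} (τ : ℝ) (m : Fin d) :
    Measurable (coordMultiplier τ m) := by
  have := (continuous_qSymbol (d := d) τ).measurable
  unfold coordMultiplier
  fun_prop

theorem measurable_restMultiplier {d : ℕ} (τ : ℝ) : Measurable (restMultiplier (d := d) τ) := by
  have := (continuous_qSymbol (d := d) τ).measurable
  have := (continuous_lastCoord (d := d)).measurable
  unfold restMultiplier
  fun_prop

theorem integrable_multiplier_mul {k : ℕ} {τ : ℝ} (hτ : 0 < τ) (f : 𝓢(Eucl (k + 2), ℂ))
    {N : Eucl (k + 2) → ℂ} (hNm : Measurable N) {a : ℝ}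
    (hN : ∀ ξ, ‖N ξ‖ ≤ a + 2 * ‖(qSymbol τ ξ)⁻¹‖) :
    Integrable fun ξ => N ξ * fourierHat f ξ := by
  have h1 := integrable_fourierHat f
  have h2 := integrable_fourierHat_div_qSymbol hτ f
  refine ((h1.norm.const_mul a).add (h2.norm.const_mul 2)).mono'
    (hNm.aestronglyMeasurable.mul h1.1) (Filter.Eventually.of_forall fun ξ => ?_)
  simp only [Pi.add_apply]
  rw [norm_mul, div_eq_mul_inv, norm_mul]
  have := mul_le_mul_of_nonneg_right (hN ξ) (norm_nonneg (fourierHat f ξ))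
  linarith

theorem sliceBounded_coordMultiplier {n : ℕ} {τ : ℝ} (hτ : 0 < τ) {m : Fin (n + 2)}
    (hm : m ≠ Fin.last (n + 1)) :
    SliceBounded m (coordMultiplier τ m) (4 * Real.pi / τ) := by
  obtain ⟨j, hj⟩ := Fin.exists_succAbove_eq hm.symm
  filter_upwards [ae_coord_ne_zero j] with η hη
  have hsr : η j ^ 2 ≤ ‖η‖ ^ 2 := by
    rw [← sq_abs]; exact pow_le_pow_left₀ (abs_nonneg _) (norm_coord_le j η) 2
  have e : ∀ t : ℝ, coordMultiplier τ m (insertCoord m (t, η)) =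
      2 * (t : ℂ) ^ 2 / (((⟨τ ^ 2 - ‖η‖ ^ 2, 2 * τ * η j⟩ : ℂ) - (t : ℂ) ^ 2) *
        ((t ^ 2 + (τ ^ 2 + ‖η‖ ^ 2) : ℝ) : ℂ)) := fun t => by
    rw [coordMultiplier, insertCoord_same, norm_insertCoord_sq]
    congr 2
    · apply Complex.ext
      · rw [qSymbol_re, norm_insertCoord_sq, Complex.sub_re, ← Complex.ofReal_pow,
          Complex.ofReal_re]
        ring
      · rw [qSymbol_im, lastCoord_succ, ← hj, insertCoord_succAbove, Complex.sub_im,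
          ← Complex.ofReal_pow, Complex.ofReal_im, sub_zero]
    · congr 1; ring
  simp_rw [e]
  exact norm_integral_coord_kernel_le hτ hη hsr rfl rfl

/-- The factor `ξ_d` cancels against `|q_τ| ≥ 2τ|ξ_d|`, and `|ξ_d - iτ| ≤ √p`. The slice is thus at
most `(1 + √p / τ) / (t² + p)`, whose integral is `π / √p + π / τ`. -/
theorem sliceBounded_restMultiplier {n : ℕ} {τ : ℝ} (hτ : 0 < τ) {m : Fin (n + 2)}
    (hm : m ≠ Fin.last (n + 1)) :
    SliceBounded m (restMultiplier τ) (2 * Real.pi / τ) := by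
  obtain ⟨j, hj⟩ := Fin.exists_succAbove_eq hm.symm
  filter_upwards [ae_coord_ne_zero j] with η hη
  have hsr : η j ^ 2 ≤ ‖η‖ ^ 2 := by
    rw [← sq_abs]; exact pow_le_pow_left₀ (abs_nonneg _) (norm_coord_le j η) 2
  set p : ℝ := τ ^ 2 + ‖η‖ ^ 2 with hp
  have hp0 : 0 < p := by positivity
  have hs : 0 < |η j| := abs_pos.mpr hη
  have hb : ∀ t : ℝ, ‖restMultiplier τ (insertCoord m (t, η))‖ ≤
      (1 + √p / τ) * (t ^ 2 + p)⁻¹ := fun t => by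
    have hP : 0 < t ^ 2 + p := by positivity
    have hl : lastCoord (insertCoord m (t, η)) = η j := by
      rw [lastCoord_succ, ← hj, insertCoord_succAbove]
    have h1 := norm_lastCoord_sub_sq τ (insertCoord m (t, η))
    have h2 := two_mul_abs_lastCoord_le_norm_qSymbol hτ (insertCoord m (t, η))
    rw [restMultiplier, norm_insertCoord_sq, show t ^ 2 + ‖η‖ ^ 2 + τ ^ 2 = t ^ 2 + p by
      rw [hp]; ring]
    rw [hl] at h1 h2 ⊢
    rw [add_mul, one_mul]
    refine (norm_add_le _ _).trans (add_le_add ?_ ?_)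
    · rw [norm_inv, Complex.norm_real, Real.norm_of_nonneg hP.le]
    · have h3 : ‖((η j : ℝ) : ℂ) - Complex.I * τ‖ ≤ √p :=
        Real.le_sqrt_of_sq_le (by rw [h1, hp]; linarith)
      rw [norm_div, norm_mul, norm_mul, norm_mul, Complex.norm_real, Complex.norm_real,
        Real.norm_of_nonneg hP.le, Real.norm_eq_abs, Complex.norm_ofNat, ← div_div,
        div_eq_mul_inv _ (t ^ 2 + p)]
      refine mul_le_mul_of_nonneg_right ?_ (by positivity)
      calc _ ≤ 2 * |η j| * √p / (2 * τ * |η j|) := by gcongr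
        _ = _ := by field_simp
  obtain ⟨hi, -⟩ := integrable_inv_sq_add hp0
  refine ⟨(hi.const_mul (1 + √p / τ)).mono' ?_ (Filter.Eventually.of_forall hb), fun x => ?_⟩
  · exact ((measurable_restMultiplier τ).comp ((insertCoord m).measurable.comp
      measurable_prodMk_right)).aestronglyMeasurable
  · refine (norm_integral_cexp_mul_le_of_le hp0 hb x).trans ?_
    have hspτ : τ ≤ √p := Real.le_sqrt_of_sq_le (by rw [hp]; nlinarith [sq_nonneg ‖η‖])
    have hsp : 0 < √p := hτ.trans_le hspτ
    have e : (1 + √p / τ) * (Real.pi / √p) = Real.pi / √p + Real.pi / τ := by field_simp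
    have h1 : Real.pi / √p ≤ Real.pi / τ := by gcongr
    rw [e]
    calc _ ≤ Real.pi / τ + Real.pi / τ := by gcongr
      _ = _ := by ring

/-! ### Claim 3 and the conclusion. -/

theorem tripleStar_add_le {d : ℕ} {u v : Eucl d → ℂ} (hu : Continuous u) (hv : Continuous v) :
    tripleStar (fun x => u x + v x) ≤ tripleStar u + tripleStar v := by
  refine iSup_le fun j => ?_
  refine (mul_le_mul_right (eLpNorm_add_le hu.aestronglyMeasurable hv.aestronglyMeasurable
    one_le_two) _).trans ?_
  rw [mul_add]
  exact add_le_add (le_iSup (fun j : ℕ => ENNReal.ofReal ((2 : ℝ) ^ (-(j : ℝ) / 2)) *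
    eLpNorm u 2 (volume.restrict (dyadicShell d j))) j)
    (le_iSup (fun j : ℕ => ENNReal.ofReal ((2 : ℝ) ^ (-(j : ℝ) / 2)) *
    eLpNorm v 2 (volume.restrict (dyadicShell d j))) j)

theorem tripleStar_sum_le {d : ℕ} {ι : Type*} (s : Finset ι) {u : ι → Eucl d → ℂ}
    (hu : ∀ i ∈ s, Continuous (u i)) :
    tripleStar (fun x => ∑ i ∈ s, u i x) ≤ ∑ i ∈ s, tripleStar (u i) := by
  classical
  induction s using Finset.induction_on with
  | empty => simp [tripleStar]
  | insert a s ha ih =>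
    have hs : ∀ i ∈ s, Continuous (u i) := fun i hi => hu i (Finset.mem_insert_of_mem hi)
    simp_rw [Finset.sum_insert ha]
    exact (tripleStar_add_le (hu a (Finset.mem_insert_self a s))
      (continuous_finsetSum s hs)).trans (add_le_add le_rfl (ih hs))

theorem fourierCheck_add {d : ℕ} {g h : Eucl d → ℂ} (hg : Integrable g) (hh : Integrable h)
    (x : Eucl d) : fourierCheck (fun ξ => g ξ + h ξ) x = fourierCheck g x + fourierCheck h x := by
  have hm : Measurable fun ξ : Eucl d => (inner ℝ x ξ : ℝ) := Continuous.measurable (by fun_prop)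
  simp only [fourierCheck, mul_add]
  rw [integral_add (integrable_cexp_mul hg hm) (integrable_cexp_mul hh hm), mul_add]

theorem fourierCheck_sum {d : ℕ} {ι : Type*} (s : Finset ι) {g : ι → Eucl d → ℂ}
    (hg : ∀ i ∈ s, Integrable (g i)) (x : Eucl d) :
    fourierCheck (fun ξ => ∑ i ∈ s, g i ξ) x = ∑ i ∈ s, fourierCheck (g i) x := by
  have hm : Measurable fun ξ : Eucl d => (inner ℝ x ξ : ℝ) := Continuous.measurable (by fun_prop)
  simp only [fourierCheck, Finset.mul_sum]
  rw [integral_finsetSum s fun i hi => integrable_cexp_mul (hg i hi) hm, Finset.mul_sum]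

theorem fourierCheck_congr_ae {d : ℕ} {g h : Eucl d → ℂ} (hgh : g =ᵐ[volume] h) :
    fourierCheck g = fourierCheck h := by
  ext x
  rw [fourierCheck, fourierCheck]
  congr 1
  refine integral_congr_ae ?_
  filter_upwards [hgh] with ξ hξ
  rw [hξ]

theorem tripleStar_conjLaplacianInv_le {k : ℕ} {τ : ℝ} (hτ : 0 < τ) (f : 𝓢(Eucl (k + 2), ℂ)) :
    tripleStar (conjLaplacianInv τ f) ≤
      ENNReal.ofReal (((k + 2) * (4 * Real.pi) + 2 * Real.pi) / τ) * tripleNorm f := by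
  let J : Finset (Fin (k + 2)) := Finset.univ.filter (· ≠ Fin.last (k + 1))
  have hci : ∀ m : Fin (k + 2), Integrable fun ξ => coordMultiplier τ m ξ * fourierHat f ξ :=
    fun m => integrable_multiplier_mul hτ f (measurable_coordMultiplier τ m) (a := 0) fun ξ => by
      rw [zero_add]; exact norm_coordMultiplier_le τ m ξ
  have hri : Integrable fun ξ : Eucl (k + 2) => restMultiplier τ ξ * fourierHat f ξ :=
    integrable_multiplier_mul hτ f (measurable_restMultiplier τ) (norm_restMultiplier_le hτ)
  have hdec : conjLaplacianInv τ f = fun x =>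
      (∑ m ∈ J, fourierCheck (fun ξ => coordMultiplier τ m ξ * fourierHat f ξ) x) +
        fourierCheck (fun ξ => restMultiplier τ ξ * fourierHat f ξ) x := by
    have hae : (fun ξ : Eucl (k + 2) => fourierHat f ξ / qSymbol τ ξ) =ᵐ[volume] fun ξ =>
        (∑ m ∈ J, coordMultiplier τ m ξ * fourierHat f ξ) +
          restMultiplier τ ξ * fourierHat f ξ := by
      filter_upwards [ae_norm_qSymbol_pos hτ] with ξ hξ
      rw [div_eq_mul_inv, inv_qSymbol_eq hτ (norm_pos_iff.mp hξ), ← Finset.sum_mul]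
      ring
    ext x
    rw [conjLaplacianInv, fourierCheck_congr_ae hae,
      fourierCheck_add (integrable_finsetSum J fun m _ => hci m) hri,
      fourierCheck_sum J fun m _ => hci m]
  have hcc : ∀ m ∈ J,
      Continuous (fourierCheck fun ξ => coordMultiplier τ m ξ * fourierHat f ξ) :=
    fun m _ => continuous_fourierCheck (hci m)
  rw [hdec]
  refine (tripleStar_add_le (continuous_finsetSum J hcc) (continuous_fourierCheck hri)).trans ?_
  have hpi := Real.pi_pos
  have h1 : ∀ m ∈ J, tripleStar (fourierCheck fun ξ => coordMultiplier τ m ξ * fourierHat f ξ) ≤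
      ENNReal.ofReal (4 * Real.pi / τ) * tripleNorm f := fun m hm =>
    tripleStar_fourierCheck_le (by positivity)
      (sliceBounded_coordMultiplier hτ (by simpa [J] using hm)) f.continuous f.integrable (hci m)
  have h2 : tripleStar (fourierCheck fun ξ => restMultiplier τ ξ * fourierHat f ξ) ≤
      ENNReal.ofReal (2 * Real.pi / τ) * tripleNorm f :=
    -- Any coordinate other than the last serves for the remainder; `0` is one.
    tripleStar_fourierCheck_le (m := 0) (by positivity)
      (sliceBounded_restMultiplier hτ (by simp [Fin.ext_iff])) f.continuous f.integrable hri
  refine (add_le_add ((tripleStar_sum_le J hcc).trans (Finset.sum_le_card_nsmul _ _ _ h1))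
    h2).trans ?_
  have hcard : (J.card : ℝ≥0∞) ≤ ENNReal.ofReal (k + 2) := by
    have : J.card ≤ k + 2 := (Finset.card_le_univ J).trans_eq (by simp)
    calc (J.card : ℝ≥0∞) ≤ ((k + 2 : ℕ) : ℝ≥0∞) := Nat.cast_le.mpr this
      _ = _ := by rw [← ENNReal.ofReal_natCast]; push_cast; rfl
  rw [nsmul_eq_mul, ← mul_assoc, ← add_mul]
  refine mul_le_mul_left ?_ _
  refine (add_le_add (mul_le_mul_left hcard _) le_rfl).trans (le_of_eq ?_)
  rw [← ENNReal.ofReal_mul (by positivity), ← ENNReal.ofReal_add (by positivity) (by positivity)]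
  congr 1
  field_simp

theorem mainTheorem8 (d : ℕ) (hd : 3 ≤ d) :
    (∀ φ : 𝓢(Eucl d, ℂ), IsLPBase φ →
      ∃ C : ℝ, 0 < C ∧ ∀ lam τ : ℝ, 0 < τ → lam = τ ^ 2 → ∀ f : 𝓢(Eucl d, ℂ),
        yStarNorm φ lam f ≤ ENNReal.ofReal C * yDotNorm (1 / 2) τ f) ∧
    (∀ χ : 𝓢(Eucl d, ℂ),
      ∃ C : ℝ, 0 < C ∧ ∀ τ : ℝ, 0 < τ → ∀ f : 𝓢(Eucl d, ℂ),
        ENNReal.ofReal (τ ^ (1 / 2 : ℝ)) * eLpNorm (fun x => χ x * f x) 2 volume ≤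
          ENNReal.ofReal C * yDotNorm (1 / 2) τ f) ∧
    (∃ C : ℝ, 0 < C ∧ ∀ τ : ℝ, 0 < τ → ∀ f : 𝓢(Eucl d, ℂ),
        Integrable (fun ξ : Eucl d => fourierHat f ξ / qSymbol τ ξ) volume ∧
        tripleStar (conjLaplacianInv τ f) ≤ ENNReal.ofReal (C / τ) * tripleNorm f) := by
  -- The form `k + 2` provides a coordinate different from the last, along which to slice.
  obtain ⟨k, rfl⟩ : ∃ k, d = k + 2 := ⟨d - 2, by omega⟩
  refine ⟨fun φ hφ => ?_, exists_cutoff_bound k, ?_⟩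
  · obtain ⟨C, hC, h⟩ := exists_yStarNorm_le k hφ
    exact ⟨C, hC, fun lam τ hτ hlam f => hlam ▸ h τ hτ f⟩
  · exact ⟨(k + 2) * (4 * Real.pi) + 2 * Real.pi, by positivity, fun τ hτ f =>
      ⟨integrable_fourierHat_div_qSymbol hτ f, tripleStar_conjLaplacianInv_le hτ f⟩⟩

end
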